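/- **Theorem ($L^p$-almost-periodicity relative to Bohr-compatible measures).** Conventions. Let $G$ be a finite abelian group with dual group $\widehat G$. For $\Gamma\subset\widehat G$ and $\rho\ge 0$, the Bohr set $B=\mathrm{Bohr}(\Gamma,\rho)=\{x\in G: |\gamma(x)-1|\le\rho \text{ for all }\gamma\in\Gamma\}$ (carrying the data $\Gamma,\rho$) has rank $d=|\Gamma|$ and radius $\rho$; $B_\tau=\mathrm{Bohr}(\Gamma,\tau\rho)$. It is regular if $1-12d|\tau|\le |B_{1+\tau}|/|B|\le 1+12d|\tau|$ whenever $12d|\tau|\le 1$. We write $\mathrm{Bohr}(\Lambda,\rho')\le\mathrm{Bohr}(\Gamma,\rho)$ if $\Lambda\supset\Gamma$ and $\rho'\le\rho$. For a positive integer $r$, $rB=B+\dots+B$ is the $r$-fold sumset. A pair $(\nu,\mu)$ of measures on $G$ is $X$-invariant if $\nu(t+Y)\le\mu(Y)$ for all $t\in X$ and $Y\subset G$. Write $\mu_X=1_X/|X|$ (also $\mu_B(S)=|S|/|B|$ for $S\subset B$), $u*v(x)=\sum_y u(y)v(x-y)$, $\|u\|_{L^p(\mu)}^p=\sum_x\mu(x)|u(x)|^p$,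 and $\|\nu\|_{\ell^1}=\nu(G)$. Statement. There are absolute constants $C_1,C_2>0$ such that the following holds. Let $m\ge 1$ be real and $\epsilon,\delta\in(0,1)$. Let $A,L$ be non-empty subsets of a finite abelian group $G$ with $\eta:=|A|/|L|\le 1$, let $B\subset G$ be a regular Bohr set of rank $d\ge 1$ and radius $\rho\in[0,2]$, and let $(\nu,\mu)$ be an $rB$-invariant pair of measures on $G$, where $r\in\mathbb N$ satisfies $r\ge C_1\log(2/\delta\eta)$. Suppose $|A+S|\le K|A|$ for a non-empty subset $S\subset B$, and put $f=\mu_A*1_L\cdot(1-\mu_A*1_L)$. Then there are a positive integer $d'$ with \[ d'\le C_2\left(m\epsilon^{-2}\log^2(2/\delta\eta)\log(2K)+\log(1/\mu_B(S))\right) \] and a regular Bohr set $B'\le B$ of rank at most $d+d'$ and radius at least $\rho\,\delta\,\eta^{1/2}/(d^2d')$ such that, for each $t\in B'$, \[ \|\mu_A*1_L(\cdot+t)-\mu_A*1_L\|_{L^{2m}(\nu)}\le\epsilon\|f\|_{L^m(\mu)}^{1/2}+\epsilon^{2-1/m}\|f\|_{L^1(\mu)}^{1/(2m)}+\delta\|\nu\|_{\ell^1}^{1/(2m)}.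 \] -/

import Mathlib

open scoped Pointwise

/-- The Bohr set `{x | |γ(x) - 1| ≤ ρ for all γ ∈ Γ}` of a set `Γ` of characters, as a set. -/
def bohr {G : Type*} [AddCommGroup G] (Γ : Finset (AddChar G ℂ)) (ρ : ℝ) : Set G :=
  {x | ∀ γ ∈ Γ, ‖γ x - 1‖ ≤ ρ}

/-- A Bohr set together with its defining data: the frequencies and the radius. -/
structure BohrSet (G : Type*) [AddCommGroup G] where
  freqs : Finset (AddChar G ℂ)
  radius : ℝ
  radius_nonneg : 0 ≤ radius

namespace BohrSet

/-- The underlying set of a Bohr set. -/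
def carrier {G : Type*} [AddCommGroup G] (B : BohrSet G) : Set G :=
  bohr B.freqs B.radius

/-- The rank: the number of frequencies. -/
def rank {G : Type*} [AddCommGroup G] (B : BohrSet G) : ℕ :=
  B.freqs.card

/-- The underlying set of the dilate `B_τ`. -/
def dilate {G : Type*} [AddCommGroup G] (B : BohrSet G) (τ : ℝ) : Set G :=
  bohr B.freqs (τ * B.radius)

/-- `B'.IsSub B` : `B'` is a sub-Bohr set of `B`, written `B' ≤ B`. -/
def IsSub {G : Type*} [AddCommGroup G] (B' B : BohrSet G) : Prop :=
  B.freqs ⊆ B'.freqs ∧ B'.radius ≤ B.radius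

/-- Regularity, with `d = rank B`:
`1 - 12 d |τ| ≤ |B_{1+τ}| / |B| ≤ 1 + 12 d |τ|` whenever `12 d |τ| ≤ 1`. -/
def IsRegular {G : Type*} [AddCommGroup G] (B : BohrSet G) : Prop :=
  ∀ τ : ℝ, 12 * (B.rank : ℝ) * |τ| ≤ 1 →
    1 - 12 * (B.rank : ℝ) * |τ| ≤ ((B.dilate (1 + τ)).ncard : ℝ) / (B.carrier.ncard : ℝ) ∧
    ((B.dilate (1 + τ)).ncard : ℝ) / (B.carrier.ncard : ℝ) ≤ 1 + 12 * (B.rank : ℝ) * |τ|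

end BohrSet

/-- The `r`-fold iterated sumset `rX = X + ⋯ + X`. -/
def iteratedSumset {G : Type*} [AddCommGroup G] (r : ℕ) (X : Set G) : Set G :=
  {t | ∃ s : Fin r → G, (∀ i, s i ∈ X) ∧ t = ∑ i, s i}

/-- The pair `(ν, μ)` is `S`-invariant: `τ_t ν ≤ μ` for all `t ∈ S`,
where `τ_t ν (X) = ν (t + X)`. -/
def IsInvariantPair {G : Type*} [AddCommGroup G] [MeasurableSpace G] (S : Set G)
    (ν μ : MeasureTheory.Measure G) : Prop :=
  ∀ t ∈ S, ∀ X : Set G, MeasurableSet X → ν ((fun x => t + x) '' X) ≤ μ X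

/-- The indicator function `1_X`. -/
def ind {G : Type*} [DecidableEq G] (X : Finset G) (x : G) : ℝ :=
  if x ∈ X then 1 else 0

/-- The uniform probability weight `μ_X = 1_X / |X|`. -/
noncomputable def unif {G : Type*} [DecidableEq G] (X : Finset G) (x : G) : ℝ :=
  ind X x / (X.card : ℝ)

/-- The convolution `f * g (x) = ∑ y, f(y) g(x - y)`. -/
def conv {G : Type*} [AddCommGroup G] [Fintype G] (f g : G → ℝ) (x : G) : ℝ :=
  ∑ y, f y * g (x - y)

/-! ### Fourier analysis on a finite abelian group. -/

section Fourier
set_option linter.unusedSectionVars false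
variable {G : Type*} [AddCommGroup G] [Fintype G]

/-! Write g = μ_A * 1_L. The proof combines random sampling, repeated smoothing and a relative form
of Chang's theorem.

Sampling: for fixed x and random a in A, 1_L(x - a) is a Bernoulli variable with mean g(x) and
variance f(x). A Rosenthal-type moment bound therefore shows that, for at least half of the n-tuples
from A, the average of the n corresponding translates of 1_L is close to g in L^{2m}(μ). Shifting
tuples by elements of S lands in (A+S)^n, which has at most K^n |A|^n elements, so by pigeonhole a
single sampled function h satisfies h(· + t) ≈ g for all t in some T ⊆ S with |T| ≥ |S| / (2K^n)
(`croot_sisask`).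

Smoothing: consequently g is almost invariant under t₀ - t for t, t₀ in T. Averaging over these
shifts k times costs only k times the error, each round using two more summands of rB
(`eLpNorm_iterate_smooth_sub_le`). In modulus it multiplies the Fourier coefficients by the k-th
power of those of μ_T. With k about 2 log(2/δη), characters where the transform of μ_T is below 1/2
are negligible against the Fourier ℓ¹ norm of g, which is at most η^{-1/2} after normalisation.
Hence a shift by t moves the smoothed function by at most δ uniformly, provided |γ(t) - 1| ≤ δ
η^{1/2} on the remaining characters (`abs_iterate_smooth_shift_sub_le`).

Spectrum: `chang_bohr` ensures this by asking t to lie in a small Bohr set on the frequencies of B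
and O(log(4|B|/|T|)) further ones. The size of T turns this number into the bound for d', and n of
order m k² ε⁻² produces the squared logarithm. Regular radii come from `exists_linear_growth_point`.
-/

/-- The Fourier transform of a real function on a finite abelian group. -/
noncomputable def ft (u : G → ℝ) (γ : AddChar G ℂ) : ℂ := ∑ x, (u x : ℂ) * γ x

lemma ft_conv (u w : G → ℝ) (γ : AddChar G ℂ) : ft (conv u w) γ = ft u γ * ft w γ := by
  unfold ft conv
  push_cast
  simp_rw [Finset.sum_mul_sum, Finset.sum_mul]
  rw [Finset.sum_comm]
  refine Finset.sum_congr rfl fun y _ => ?_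
  refine Fintype.sum_equiv (Equiv.subRight y) _ _ fun x => ?_
  have : γ x = γ y * γ (x - y) := by rw [← AddChar.map_add_eq_mul]; simp
  simp only [Equiv.subRight_apply, this]
  ring

lemma ft_shift (u : G → ℝ) (t : G) (γ : AddChar G ℂ) :
    ft (fun x => u (x + t)) γ = γ (-t) * ft u γ := by
  unfold ft
  rw [Finset.mul_sum]
  refine Fintype.sum_equiv (Equiv.addRight t) _ _ fun x => ?_
  have : γ x = γ (-t) * γ (x + t) := by rw [← AddChar.map_add_eq_mul]; simp
  simp only [Equiv.coe_addRight, this]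
  ring

lemma ft_inversion (u : G → ℝ) (x : G) :
    ∑ γ : AddChar G ℂ, ft u γ * γ (-x) = Fintype.card G * (u x : ℂ) := by
  classical
  unfold ft
  simp_rw [Finset.sum_mul]
  rw [Finset.sum_comm]
  have h : ∀ y : G, ∑ γ : AddChar G ℂ, (u y : ℂ) * γ y * γ (-x)
      = if y = x then (u y : ℂ) * Fintype.card G else 0 := by
    intro y
    have := AddChar.sum_apply_eq_ite (y - x)
    simp_rw [mul_assoc, ← AddChar.map_add_eq_mul, ← Finset.mul_sum, ← sub_eq_add_neg]
    rw [this]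
    simp [sub_eq_zero]
  simp_rw [h]
  simp [mul_comm]

lemma ft_parseval (u : G → ℝ) :
    ∑ γ : AddChar G ℂ, ‖ft u γ‖ ^ 2 = Fintype.card G * ∑ x, u x ^ 2 := by
  have key : ∑ γ : AddChar G ℂ, ft u γ * (starRingEnd ℂ) (ft u γ)
      = ∑ x, (u x : ℂ) * (Fintype.card G * (u x : ℂ)) := by
    simp_rw [← ft_inversion]
    have h : ∀ γ : AddChar G ℂ, (starRingEnd ℂ) (ft u γ) = ∑ x, (u x : ℂ) * γ (-x) := by
      intro γ
      simp [ft, AddChar.map_neg_eq_conj]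
    simp_rw [h, Finset.mul_sum]
    rw [Finset.sum_comm]
    refine Finset.sum_congr rfl fun x _ => Finset.sum_congr rfl fun γ _ => by ring
  have h2 : ((∑ γ : AddChar G ℂ, ‖ft u γ‖ ^ 2 : ℝ) : ℂ)
      = ((Fintype.card G * ∑ x, u x ^ 2 : ℝ) : ℂ) := by
    push_cast
    simp_rw [Complex.mul_conj'] at key
    rw [key, Finset.mul_sum]
    refine Finset.sum_congr rfl fun x _ => by ring
  exact_mod_cast h2

lemma norm_ft_le (u : G → ℝ) (hu : ∀ x, 0 ≤ u x) (γ : AddChar G ℂ) : ‖ft u γ‖ ≤ ∑ x, u x := by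
  unfold ft
  refine (norm_sum_le _ _).trans (le_of_eq (Finset.sum_congr rfl fun x _ => ?_))
  simp [abs_of_nonneg (hu x)]

variable [DecidableEq G]

lemma unif_nonneg (X : Finset G) (x : G) : 0 ≤ unif X x := by
  unfold unif ind; split_ifs <;> positivity

lemma sum_unif_mul (X : Finset G) (u : G → ℝ) :
    ∑ x, unif X x * u x = (∑ x ∈ X, u x) / X.card := by
  simp [unif, ind, Finset.sum_ite_mem, div_eq_inv_mul, Finset.mul_sum]

lemma sum_unif {X : Finset G} (hX : X.Nonempty) : ∑ x, unif X x = 1 := by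
  have := sum_unif_mul X (fun _ => 1)
  have h : (X.card : ℝ) ≠ 0 := by simp [hX.ne_empty]
  simpa [h] using this

lemma sum_unif_sq {X : Finset G} : ∑ x, unif X x ^ 2 = 1 / X.card := by
  have h : ∑ x, unif X x ^ 2 = ∑ x, unif X x * unif X x :=
    Finset.sum_congr rfl fun x _ => by ring
  rw [h, sum_unif_mul, Finset.sum_congr rfl (g := fun _ => 1 / (X.card : ℝ))]
  · by_cases hX : X.card = 0
    · simp [hX]
    · have : (X.card : ℝ) ≠ 0 := by exact_mod_cast hX
      field_simp
      simp [this]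
  · intro x hx; simp [unif, ind, hx]

lemma norm_ft_unif_le_one (X : Finset G) (γ : AddChar G ℂ) : ‖ft (unif X) γ‖ ≤ 1 := by
  rcases X.eq_empty_or_nonempty with rfl | hX
  · simp [ft, unif, ind]
  · exact (norm_ft_le _ (unif_nonneg X) γ).trans (sum_unif hX).le

/-- The Fourier algebra norm of `μ_A * 1_L`. -/
lemma sum_norm_ft_conv_le {A L : Finset G} (hA : A.Nonempty) :
    ∑ γ : AddChar G ℂ, ‖ft (conv (unif A) (ind L)) γ‖
      ≤ Fintype.card G * √(L.card / A.card) := by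
  simp_rw [ft_conv, norm_mul]
  -- Cauchy–Schwarz, then Parseval for each factor.
  refine (Real.sum_mul_le_sqrt_mul_sqrt _ _ _).trans (le_of_eq ?_)
  rw [ft_parseval, ft_parseval, sum_unif_sq]
  have h : ∑ x, ind L x ^ 2 = L.card := by simp [ind]
  rw [h, ← Real.sqrt_mul (by positivity)]
  have : (Fintype.card G : ℝ) * (1 / A.card) * (Fintype.card G * L.card)
    = (Fintype.card G : ℝ) ^ 2 * (L.card / A.card) := by ring
  rw [this, Real.sqrt_mul (by positivity), Real.sqrt_sq (by positivity)]

/-- A pointwise bound for `u(x+t) - u(x)` through the Fourier coefficients of `u`. -/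
lemma abs_shift_sub_le (u : G → ℝ) (x t : G) :
    Fintype.card G * |u (x + t) - u x| ≤ ∑ γ : AddChar G ℂ, ‖ft u γ‖ * ‖γ t - 1‖ := by
  have h : ((Fintype.card G : ℂ)) * ((u (x + t) : ℂ) - u x)
      = ∑ γ : AddChar G ℂ, ft u γ * (γ (-x) * γ (-t) - γ (-x)) := by
    rw [mul_sub, ← ft_inversion, ← ft_inversion, ← Finset.sum_sub_distrib]
    refine Finset.sum_congr rfl fun γ _ => ?_
    rw [← AddChar.map_add_eq_mul, neg_add]; ring
  have h2 : Fintype.card G * |u (x + t) - u x|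
      = ‖((Fintype.card G : ℂ)) * ((u (x + t) : ℂ) - u x)‖ := by
    rw [norm_mul, ← Complex.ofReal_sub, Complex.norm_real]; simp
  rw [h2, h]
  refine (norm_sum_le _ _).trans (Finset.sum_le_sum fun γ _ => ?_)
  rw [norm_mul]
  refine mul_le_mul_of_nonneg_left (le_of_eq ?_) (norm_nonneg _)
  have h3 : γ (-x) * γ (-t) - γ (-x) = γ (-x) * γ (-t) * (1 - γ t) := by
    have : γ (-t) * γ t = 1 := by rw [← AddChar.map_add_eq_mul]; simp
    linear_combination γ (-x) * this
  rw [h3, norm_mul, norm_mul, AddChar.norm_apply, AddChar.norm_apply, norm_sub_rev]; simp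

end Fourier

/-! ### Bohr sets: sums, covering and right-continuity. -/

section Bohr
set_option linter.unusedSectionVars false
variable {G : Type*} [AddCommGroup G]

lemma bohr_mono (Γ : Finset (AddChar G ℂ)) {ρ σ : ℝ} (h : ρ ≤ σ) : bohr Γ ρ ⊆ bohr Γ σ :=
  fun _ hx γ hγ => (hx γ hγ).trans h

lemma zero_mem_bohr (Γ : Finset (AddChar G ℂ)) {ρ : ℝ} (h : 0 ≤ ρ) : (0 : G) ∈ bohr Γ ρ :=
  fun γ _ => by simpa using h

lemma add_mem_bohr [Finite G] {Γ : Finset (AddChar G ℂ)} {ρ σ : ℝ} {x y : G} (hx : x ∈ bohr Γ ρ)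
    (hy : y ∈ bohr Γ σ) : x + y ∈ bohr Γ (ρ + σ) := by
  intro γ hγ
  have h : γ (x + y) - 1 = γ x * (γ y - 1) + (γ x - 1) := by
    rw [AddChar.map_add_eq_mul]; ring
  rw [h]
  refine (norm_add_le _ _).trans ?_
  rw [norm_mul, AddChar.norm_apply, one_mul, add_comm]
  exact add_le_add (hx γ hγ) (hy γ hγ)

lemma AddChar.norm_sub_apply_sub_one [Finite G] (γ : AddChar G ℂ) (x y : G) :
    ‖γ (x - y) - 1‖ = ‖γ x - γ y‖ := by
  have h : γ x - γ y = γ y * (γ (x - y) - 1) := by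
    rw [mul_sub, ← AddChar.map_add_eq_mul]; simp
  rw [h, norm_mul, AddChar.norm_apply, one_mul]

lemma neg_mem_bohr [Finite G] {Γ : Finset (AddChar G ℂ)} {ρ : ℝ} {x : G} (hx : x ∈ bohr Γ ρ) :
    -x ∈ bohr Γ ρ := by
  intro γ hγ
  have := AddChar.norm_sub_apply_sub_one γ 0 x
  rw [zero_sub, AddChar.map_zero_eq_one, norm_sub_rev (1 : ℂ)] at this
  rw [this]; exact hx γ hγ

variable [Fintype G]

lemma ncard_bohr_pos (Γ : Finset (AddChar G ℂ)) {ρ : ℝ} (h : 0 ≤ ρ) : 0 < (bohr Γ ρ).ncard :=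
  (Set.ncard_pos (Set.toFinite _)).2 ⟨0, zero_mem_bohr Γ h⟩

lemma ncard_bohr_mono (Γ : Finset (AddChar G ℂ)) {ρ σ : ℝ} (h : ρ ≤ σ) :
    (bohr Γ ρ).ncard ≤ (bohr Γ σ).ncard :=
  Set.ncard_le_ncard (bohr_mono Γ h) (Set.toFinite _)

/-- The Bohr set as a finset. -/
noncomputable def bohrFin (Γ : Finset (AddChar G ℂ)) (ρ : ℝ) : Finset G :=
  (Set.toFinite (bohr Γ ρ)).toFinset

@[simp] lemma mem_bohrFin {Γ : Finset (AddChar G ℂ)} {ρ : ℝ} {x : G} :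
    x ∈ bohrFin Γ ρ ↔ x ∈ bohr Γ ρ := by simp [bohrFin]

lemma card_bohrFin (Γ : Finset (AddChar G ℂ)) (ρ : ℝ) :
    (bohrFin Γ ρ).card = (bohr Γ ρ).ncard := by
  rw [bohrFin, Set.ncard_eq_toFinset_card _ (Set.toFinite _)]

lemma exists_floor_near {ρ x y : ℝ} (hρ : 0 < ρ) (hx : |x| ≤ ρ) (hy : |y| ≤ ρ)
    (h : ⌊(x + ρ) * (256 / ρ)⌋₊ = ⌊(y + ρ) * (256 / ρ)⌋₊) : |x - y| ≤ ρ / 256 := by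
  rw [abs_le] at hx hy
  have hc : 0 < 256 / ρ := by positivity
  have h1 := Nat.floor_le (a := (x + ρ) * (256 / ρ)) (mul_nonneg (by linarith) hc.le)
  have h2 := Nat.floor_le (a := (y + ρ) * (256 / ρ)) (mul_nonneg (by linarith) hc.le)
  have h3 := Nat.lt_floor_add_one ((x + ρ) * (256 / ρ))
  have h4 := Nat.lt_floor_add_one ((y + ρ) * (256 / ρ))
  rw [h] at h1 h3
  have e : ρ / 256 * (256 / ρ) = 1 := by field_simp
  rw [abs_le]
  constructor
  · refine le_of_mul_le_mul_right ?_ hc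
    nlinarith
  · refine le_of_mul_le_mul_right ?_ hc
    nlinarith

lemma floor_mem_range {ρ x : ℝ} (hρ : 0 < ρ) (hx : |x| ≤ ρ) :
    ⌊(x + ρ) * (256 / ρ)⌋₊ ∈ Finset.range 513 := by
  rw [abs_le] at hx
  rw [Finset.mem_range, Nat.floor_lt (mul_nonneg (by linarith) (by positivity))]
  have e : ρ * (256 / ρ) = 256 := by field_simp
  have hc : 0 < 256 / ρ := by positivity
  push_cast
  nlinarith

/-- A Bohr set is covered by boundedly many translates of a fixed small dilate, per frequency. -/
lemma ncard_bohr_le (Γ : Finset (AddChar G ℂ)) {ρ : ℝ} (hρ : 0 < ρ) :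
    (bohr Γ ρ).ncard ≤ (513 ^ 2) ^ Γ.card * (bohr Γ (ρ / 128)).ncard := by
  classical
  -- Record the cell of width ρ/256 containing the real and the imaginary part of γ(x) - 1: at most
  -- 513 cells each. Two points with equal record differ by at most ρ/256 in each part, so by at
  -- most ρ/128 in norm, and subtracting one point of a fibre injects the fibre into the small
  -- dilate.
  let F : G → (Γ → ℕ × ℕ) := fun x γ =>
    (⌊((γ.1 x - 1).re + ρ) * (256 / ρ)⌋₊, ⌊((γ.1 x - 1).im + ρ) * (256 / ρ)⌋₊)
  have hfib : ∀ a ∈ (bohrFin Γ ρ).image F,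
      ((bohrFin Γ ρ).filter fun x => F x = a).card ≤ (bohrFin Γ (ρ / 128)).card := by
    intro a ha
    obtain ⟨y, hy, rfl⟩ := Finset.mem_image.1 ha
    refine Finset.card_le_card_of_injOn (fun x => x - y) ?_ (fun x _ z _ h => by simpa using h)
    intro x hx
    rw [Finset.mem_coe, Finset.mem_filter, mem_bohrFin] at hx
    rw [mem_bohrFin] at hy
    rw [Finset.mem_coe, mem_bohrFin]
    intro γ hγ
    rw [AddChar.norm_sub_apply_sub_one]
    have h := congrFun hx.2 ⟨γ, hγ⟩
    simp only [F, Prod.mk.injEq] at h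
    have h1 := exists_floor_near hρ ((Complex.abs_re_le_norm _).trans (hx.1 γ hγ))
      ((Complex.abs_re_le_norm _).trans (hy γ hγ)) h.1
    have h2 := exists_floor_near hρ ((Complex.abs_im_le_norm _).trans (hx.1 γ hγ))
      ((Complex.abs_im_le_norm _).trans (hy γ hγ)) h.2
    have h3 := Complex.norm_le_abs_re_add_abs_im (γ x - γ y)
    simp only [Complex.sub_re, Complex.sub_im, sub_sub_sub_cancel_right] at h1 h2 h3
    linarith
  have h := Finset.card_le_mul_card_image (bohrFin Γ ρ) _ hfib
  have himg : ((bohrFin Γ ρ).image F).card ≤ (513 ^ 2) ^ Γ.card := by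
    have hsub : (bohrFin Γ ρ).image F ⊆
        Fintype.piFinset fun _ : Γ => Finset.range 513 ×ˢ Finset.range 513 := by
      intro a ha
      obtain ⟨y, hy, rfl⟩ := Finset.mem_image.1 ha
      rw [mem_bohrFin] at hy
      rw [Fintype.mem_piFinset]
      intro γ
      have h1 := floor_mem_range hρ ((Complex.abs_re_le_norm _).trans (hy γ γ.2))
      have h2 := floor_mem_range hρ ((Complex.abs_im_le_norm _).trans (hy γ γ.2))
      rw [Finset.mem_product]
      exact ⟨h1, h2⟩
    refine (Finset.card_le_card hsub).trans (le_of_eq ?_)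
    rw [Fintype.card_piFinset]
    simp only [Finset.card_product, Finset.card_range, Finset.prod_const, Finset.card_univ,
      Fintype.card_coe]
    norm_num
  rw [card_bohrFin, card_bohrFin] at h
  calc _ ≤ _ := h
    _ ≤ _ := by rw [mul_comm]; exact Nat.mul_le_mul_right _ himg

/-- Cardinalities of Bohr sets are right-continuous in the radius. -/
lemma exists_bohr_eq (Γ : Finset (AddChar G ℂ)) (ρ : ℝ) :
    ∃ σ > ρ, bohr Γ σ = bohr Γ ρ := by
  classical
  have h : ∀ x : G, ∃ σ > ρ, x ∈ bohr Γ σ → x ∈ bohr Γ ρ := by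
    intro x
    by_cases hx : x ∈ bohr Γ ρ
    · exact ⟨ρ + 1, by linarith, fun _ => hx⟩
    · have hx' := hx
      simp only [bohr, Set.mem_ofPred_eq, not_forall, not_le] at hx'
      obtain ⟨γ, hγ, hlt⟩ := hx'
      refine ⟨(ρ + ‖γ x - 1‖) / 2, by linarith, fun h => ?_⟩
      have := h γ hγ
      linarith
  choose σ hσ hmem using h
  refine ⟨Finset.univ.inf' ⟨0, Finset.mem_univ _⟩ σ, ?_, ?_⟩
  · exact (Finset.lt_inf'_iff _).2 fun x _ => hσ x
  · refine Set.Subset.antisymm (fun x hx => hmem x ?_) (bohr_mono Γ ?_)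
    · exact bohr_mono Γ (Finset.inf'_le _ (Finset.mem_univ x)) hx
    · exact ((Finset.lt_inf'_iff _).2 fun x _ => hσ x).le

end Bohr

/-! ### Existence of regular dilates. -/

/-- A monotone step function of small total growth has a point at which its increments in both
directions are bounded linearly. -/
lemma exists_linear_growth_point {φ : ℝ → ℝ} (hφ : Monotone φ)
    (hrc : ∀ u, ∃ w > u, φ w = φ u) {a' a b b' α : ℝ} (ha : a' ≤ a) (hab : a ≤ b) (hb : b ≤ b')
    (hα : 0 ≤ α) (hg : 2 * (φ b' - φ a') < α * (b - a)) :
    ∃ u ∈ Set.Icc a b, (∀ v ∈ Set.Icc u b', φ v ≤ φ u + α * (v - u)) ∧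
      ∀ v ∈ Set.Icc a' u, φ u - α * (u - v) ≤ φ v := by
  by_contra hcon
  push Not at hcon
  -- In terms of the tilted function ψ, a point u is good exactly when ψ(u) is both its maximum over
  -- [u, b'] and its minimum over [a', u], that is, ψ(u) = M(u) = m(u). Both M and m decrease with
  -- slope at most α.
  set ψ : ℝ → ℝ := fun u => φ u - α * u with hψ
  set M : ℝ → ℝ := fun u => sSup (ψ '' Set.Icc u b') with hM
  set m : ℝ → ℝ := fun u => sInf (ψ '' Set.Icc a' u) with hm
  have hlocal : ∀ u w, φ w = φ u → ∀ y ∈ Set.Icc u w, φ y = φ u := fun u w h y hy =>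
    le_antisymm ((hφ hy.2).trans h.le) (hφ hy.1)
  have bddM : ∀ u, BddAbove (ψ '' Set.Icc u b') := by
    intro u
    refine ⟨φ b' - α * u, ?_⟩
    rintro _ ⟨w, hw, rfl⟩
    have := hφ hw.2
    have := mul_le_mul_of_nonneg_left hw.1 hα
    simp only [hψ]; linarith
  have bddm : ∀ u, BddBelow (ψ '' Set.Icc a' u) := by
    intro u
    refine ⟨φ a' - α * u, ?_⟩
    rintro _ ⟨w, hw, rfl⟩
    have := hφ hw.1
    have := mul_le_mul_of_nonneg_left hw.2 hα
    simp only [hψ]; linarith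
  have leM : ∀ {u w}, u ≤ w → w ≤ b' → ψ w ≤ M u := fun h1 h2 =>
    le_csSup (bddM _) ⟨_, ⟨h1, h2⟩, rfl⟩
  have mle : ∀ {u w}, a' ≤ w → w ≤ u → m u ≤ ψ w := fun h1 h2 =>
    csInf_le (bddm _) ⟨_, ⟨h1, h2⟩, rfl⟩
  have Mle : ∀ {u c}, u ≤ b' → (∀ w, u ≤ w → w ≤ b' → ψ w ≤ c) → M u ≤ c := by
    intro u c hu h
    refine csSup_le ⟨ψ u, u, ⟨le_rfl, hu⟩, rfl⟩ ?_
    rintro _ ⟨w, hw, rfl⟩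
    exact h w hw.1 hw.2
  have lem : ∀ {u c}, a' ≤ u → (∀ w, a' ≤ w → w ≤ u → c ≤ ψ w) → c ≤ m u := by
    intro u c hu h
    refine le_csInf ⟨ψ u, u, ⟨hu, le_rfl⟩, rfl⟩ ?_
    rintro _ ⟨w, hw, rfl⟩
    exact h w hw.1 hw.2
  have Manti : ∀ {u y}, u ≤ y → y ≤ b' → M y ≤ M u := fun h1 h2 =>
    Mle h2 fun w hw1 hw2 => leM (h1.trans hw1) hw2
  have manti : ∀ {u y}, a' ≤ u → u ≤ y → m y ≤ m u := fun h1 h2 =>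
    lem h1 fun w hw1 hw2 => mle hw1 (hw2.trans h2)
  have Mlip : ∀ {u y}, u ≤ y → y ≤ b' → M u ≤ M y + α * (y - u) := by
    intro u y h1 h2
    refine Mle (h1.trans h2) fun w hw1 hw2 => ?_
    rcases le_total y w with h | h
    · have := leM h hw2
      have := mul_nonneg hα (sub_nonneg.2 h1)
      linarith
    · have e1 := leM (le_refl y) h2
      have e2 := hφ h
      have e3 := mul_le_mul_of_nonneg_left hw1 hα
      simp only [hψ] at e1 ⊢
      linarith
  have mlip : ∀ {u y}, a' ≤ u → u ≤ y → m u ≤ m y + α * (y - u) := by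
    intro u y h1 h2
    have : m u - α * (y - u) ≤ m y := by
      refine lem (h1.trans h2) fun w hw1 hw2 => ?_
      rcases le_total w u with h | h
      · have := mle hw1 h
        have := mul_nonneg hα (sub_nonneg.2 h2)
        linarith
      · have e1 := mle h1 (le_refl u)
        have e2 := hφ h
        have e3 := mul_le_mul_of_nonneg_left hw2 hα
        simp only [hψ] at e1 ⊢
        linarith
    linarith
  set H : ℝ → ℝ := fun u => M u + m u with hH
  have hcont : ContinuousOn H (Set.Icc a b) := by
    have hmul : ∀ u ∈ Set.Icc a b, ∀ y ∈ Set.Icc a b, u ≤ y →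
        |H u - H y| ≤ 2 * α * |u - y| := by
      intro u hu y hy h
      have e1 := Manti h (hy.2.trans hb)
      have e2 := manti (ha.trans hu.1) h
      have e3 := Mlip h (hy.2.trans hb)
      have e4 := mlip (ha.trans hu.1) h
      rw [abs_of_nonneg (by simp only [hH]; linarith), abs_of_nonpos (by linarith)]
      simp only [hH]; linarith
    have : LipschitzOnWith (Real.toNNReal (2 * α)) H (Set.Icc a b) := by
      refine LipschitzOnWith.of_dist_le_mul fun u hu y hy => ?_
      rw [Real.coe_toNNReal _ (by positivity), Real.dist_eq, Real.dist_eq]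
      rcases le_total u y with h | h
      · exact hmul u hu y hy h
      · rw [abs_sub_comm, abs_sub_comm u y]; exact hmul y hy u hu h
    exact this.continuousOn
  -- Continuous induction. At a bad point one of M, m is constant for a short distance to the right,
  -- since φ is constant there and the extremum is attained elsewhere with room to spare. So H = M +
  -- m falls at rate at most α instead of 2α.
  have hsub : Set.Icc a b ⊆ {x | H a - α * (x - a) ≤ H x} := by
    refine IsClosed.Icc_subset_of_forall_exists_gt ?_ (by simp) ?_
    · have := isClosed_Icc.isClosed_le (s := Set.Icc a b) (f := fun x => H a - α * (x - a))
        (g := H) (by fun_prop) hcont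
      convert this using 1
      ext x; simp [and_comm]
    · rintro x ⟨hx, hxab⟩ y hy
      rw [Set.mem_ofPred_eq] at hx
      have hxI : x ∈ Set.Icc a b := ⟨hxab.1, hxab.2.le⟩
      obtain ⟨w, hw, hwe⟩ := hrc x
      have hloc := hlocal x w hwe
      suffices h : ∃ z, x < z ∧ z ≤ y ∧ z ≤ b ∧ H x - α * (z - x) ≤ H z by
        obtain ⟨z, h1, h2, h3, h4⟩ := h
        refine ⟨z, ?_, h1, h2⟩
        rw [Set.mem_ofPred_eq]; linarith
      by_cases hup : ∀ v ∈ Set.Icc x b', φ v ≤ φ x + α * (v - x)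
      · obtain ⟨v, hv, hvlt⟩ := hcon x hxI hup
        have hv' : ψ v < ψ x := by simp only [hψ]; linarith
        have hpos : 0 < (ψ x - ψ v) / (α + 1) := by
          have : 0 < ψ x - ψ v := by linarith
          positivity
        refine ⟨min (min y b) (min w (x + (ψ x - ψ v) / (α + 1))),
          by simp only [lt_min_iff]; exact ⟨⟨hy, hxab.2⟩, hw, by linarith⟩,
          (min_le_left _ _).trans (min_le_left _ _), (min_le_left _ _).trans (min_le_right _ _), ?_⟩
        set z := min (min y b) (min w (x + (ψ x - ψ v) / (α + 1))) with hz
        have hxz : x ≤ z := by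
          simp only [hz, le_min_iff]; exact ⟨⟨le_of_lt hy, hxab.2.le⟩, hw.le, by linarith⟩
        have hzb : z ≤ b := (min_le_left _ _).trans (min_le_right _ _)
        have hzw : z ≤ w := (min_le_right _ _).trans (min_le_left _ _)
        have hzz : z - x ≤ (ψ x - ψ v) / (α + 1) := by
          have : z ≤ x + (ψ x - ψ v) / (α + 1) := (min_le_right _ _).trans (min_le_right _ _)
          linarith
        have hzz2 : α * (z - x) ≤ ψ x - ψ v := by
          rw [le_div_iff₀ (by linarith)] at hzz
          nlinarith
        have e1 : m x ≤ m z := by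
          refine lem ((ha.trans hxab.1).trans hxz) fun t ht1 ht2 => ?_
          rcases le_total t x with h | h
          · exact mle ht1 h
          · have f1 := hloc t ⟨h, ht2.trans hzw⟩
            have f2 := mle hv.1 hv.2
            have f3 := mul_le_mul_of_nonneg_left ht2 hα
            have f4 : ψ t = ψ x - α * (t - x) := by simp only [hψ, f1]; ring
            linarith
        have e2 := Mlip hxz (hzb.trans hb)
        simp only [hH]; linarith
      · push Not at hup
        obtain ⟨v, hv, hvlt⟩ := hup
        have hv' : ψ x < ψ v := by simp only [hψ]; linarith
        have hxv : x < v := lt_of_le_of_ne hv.1 (by rintro rfl; exact lt_irrefl _ hv')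
        refine ⟨min (min y b) (min w v),
          by simp only [lt_min_iff]; exact ⟨⟨hy, hxab.2⟩, hw, hxv⟩,
          (min_le_left _ _).trans (min_le_left _ _), (min_le_left _ _).trans (min_le_right _ _), ?_⟩
        set z := min (min y b) (min w v) with hz
        have hxz : x ≤ z := by
          simp only [hz, le_min_iff]; exact ⟨⟨le_of_lt hy, hxab.2.le⟩, hw.le, hxv.le⟩
        have hzb : z ≤ b := (min_le_left _ _).trans (min_le_right _ _)
        have hzw : z ≤ w := (min_le_right _ _).trans (min_le_left _ _)
        have hzv : z ≤ v := (min_le_right _ _).trans (min_le_right _ _)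
        have e1 : M x ≤ M z := by
          refine Mle ((hxz.trans hzb).trans hb) fun t ht1 ht2 => ?_
          rcases le_total z t with h | h
          · exact leM h ht2
          · have f1 := hloc t ⟨ht1, h.trans hzw⟩
            have f2 := leM hzv hv.2
            have f3 := mul_le_mul_of_nonneg_left ht1 hα
            have f4 : ψ t = ψ x - α * (t - x) := by simp only [hψ, f1]; ring
            linarith
        have e2 := mlip (ha.trans hxab.1) hxz
        simp only [hH]; linarith
  -- The trivial bounds H(b) ≤ 2(φ(b') - αb) and H(a) ≥ 2(φ(a') - αa) now force 2(φ(b') - φ(a')) ≥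
  -- α(b - a).
  have hfin := hsub ⟨hab, le_rfl⟩
  rw [Set.mem_ofPred_eq] at hfin
  have e1 : M b ≤ φ b' - α * b := Mle hb fun w h1 h2 => by
    have f1 := hφ h2
    have f2 := mul_le_mul_of_nonneg_left h1 hα
    simp only [hψ]; linarith
  have e2 : m b ≤ φ b' - α * b := (mle (ha.trans hab) le_rfl).trans (by
    have := hφ hb
    simp only [hψ]; linarith)
  have e3 : φ a' - α * a ≤ m a := lem ha fun w h1 h2 => by
    have f1 := hφ h1
    have f2 := mul_le_mul_of_nonneg_left h2 hα
    simp only [hψ]; linarith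
  have e4 : φ a' - α * a ≤ M a := le_trans (by
    have := hφ ha
    simp only [hψ]; linarith) (leM le_rfl (hab.trans hb))
  simp only [hH] at hfin
  linarith

section Regular
variable {G : Type*} [AddCommGroup G] [Fintype G]

/-- Concave Bernoulli gives 2^x ≤ 1 + x, and 2/3 < log 2. The factor 2/3 converts the logarithmic
slope 8d into the linear constant 12d of regularity. -/
lemma exp_two_thirds_le {x : ℝ} (h0 : 0 ≤ x) (h1 : x ≤ 1) : Real.exp (2 / 3 * x) ≤ 1 + x := by
  have h2 := Real.log_two_gt_d9
  have h3 := rpow_one_add_le_one_add_mul_self (s := 1) (by norm_num) h0 h1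
  rw [show (1 : ℝ) + 1 = 2 by norm_num, mul_one, Real.rpow_def_of_pos (by norm_num)] at h3
  refine (Real.exp_le_exp.2 ?_).trans h3
  nlinarith

/-- Every Bohr set has a regular dilate, by a factor in `[1/64, 1]`. -/
lemma exists_regular_dilate {Γ : Finset (AddChar G ℂ)} (hΓ : Γ.Nonempty) {ρ : ℝ} (hρ : 0 ≤ ρ) :
    ∃ B : BohrSet G, B.freqs = Γ ∧ ρ / 64 ≤ B.radius ∧ B.radius ≤ ρ ∧ B.IsRegular := by
  rcases hρ.eq_or_lt with rfl | hρ
  · refine ⟨⟨Γ, 0, le_rfl⟩, rfl, by simp, le_rfl, fun τ _ => ?_⟩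
    have h : BohrSet.dilate (⟨Γ, 0, le_rfl⟩ : BohrSet G) (1 + τ)
      = BohrSet.carrier (⟨Γ, 0, le_rfl⟩ : BohrSet G) := by
      simp [BohrSet.dilate, BohrSet.carrier]
    have hp : ((BohrSet.carrier (⟨Γ, 0, le_rfl⟩ : BohrSet G)).ncard : ℝ) ≠ 0 := by
      exact_mod_cast (ncard_bohr_pos Γ le_rfl).ne'
    rw [h, div_self hp]
    have : 0 ≤ 12 * ((BohrSet.rank (⟨Γ, 0, le_rfl⟩ : BohrSet G) : ℕ) : ℝ) * |τ| := by positivity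
    constructor <;> linarith
  set d : ℝ := (Γ.card : ℝ) with hd
  have hd1 : 1 ≤ d := by rw [hd]; exact_mod_cast hΓ.card_pos
  set N : ℝ → ℝ := fun s => ((bohr Γ s).ncard : ℝ) with hN
  have Npos : ∀ s, 0 ≤ s → 0 < N s := fun s hs => by
    simp only [hN]; exact_mod_cast ncard_bohr_pos Γ hs
  have Nmono : ∀ s t, s ≤ t → N s ≤ N t := fun s t h => by
    simp only [hN]; exact_mod_cast ncard_bohr_mono Γ h
  set φ : ℝ → ℝ := fun u => Real.log (N (Real.exp u)) with hφ
  have hmono : Monotone φ := fun u v h =>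
    Real.log_le_log (Npos _ (Real.exp_pos _).le) (Nmono _ _ (Real.exp_le_exp.2 h))
  have hrc : ∀ u, ∃ w > u, φ w = φ u := by
    intro u
    obtain ⟨σ, hσ, he⟩ := exists_bohr_eq Γ (Real.exp u)
    have h0 : 0 < σ := (Real.exp_pos u).trans hσ
    refine ⟨Real.log σ, (Real.lt_log_iff_exp_lt h0).2 hσ, ?_⟩
    simp only [hφ, hN, Real.exp_log h0, he]
  have l2 : 0 < Real.log 2 := Real.log_pos (by norm_num)
  set t := Real.log ρ with ht
  have et : Real.exp t = ρ := Real.exp_log hρ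
  have e128 : Real.exp (t - 7 * Real.log 2) = ρ / 128 := by
    rw [Real.exp_sub, et, show 7 * Real.log 2 = Real.log (2 ^ 7) by simp,
      Real.exp_log (by norm_num)]; norm_num
  have hgrow : φ t - φ (t - 7 * Real.log 2) ≤ d * (2 * Real.log 513) := by
    have h := ncard_bohr_le Γ hρ
    have h' : N ρ ≤ (513 ^ 2) ^ Γ.card * N (ρ / 128) := by simp only [hN]; exact_mod_cast h
    simp only [hφ, et, e128]
    have h2 := Real.log_le_log (Npos _ hρ.le) h'
    rw [Real.log_mul (by positivity) (Npos _ (by positivity)).ne', Real.log_pow, Real.log_pow] at h2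
    rw [hd]; push_cast at h2; linarith
  have h513 : Real.log 513 < 10 * Real.log 2 := by
    rw [show 10 * Real.log 2 = Real.log (2 ^ 10) by simp]
    exact Real.log_lt_log (by norm_num) (by norm_num)
  -- On the logarithmic scale the growth over a factor 128 is below 20 d log 2, and twice that is 40
  -- d log 2 = 8d · 5 log 2. The margins of log 2 at both ends leave room for the factor 1 + τ; the
  -- lower endpoint gives ρ/64.
  obtain ⟨u, hu, hup, hdown⟩ := exists_linear_growth_point hmono hrc
    (a' := t - 7 * Real.log 2) (a := t - 6 * Real.log 2) (b := t - Real.log 2) (b' := t)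
    (α := 8 * d) (by linarith) (by linarith) (by linarith) (by linarith) (by nlinarith)
  have hpos := Real.exp_pos u
  refine ⟨⟨Γ, Real.exp u, hpos.le⟩, rfl, ?_, ?_, fun τ hτ => ?_⟩
  · have := Real.exp_le_exp.2 hu.1
    rw [Real.exp_sub, et, show 6 * Real.log 2 = Real.log (2 ^ 6) by simp,
      Real.exp_log (by norm_num)] at this
    norm_num at this; exact this
  · have := Real.exp_le_exp.2 (hu.2.trans (sub_le_self t l2.le))
    rwa [et] at this
  have hτ' : 12 * d * |τ| ≤ 1 := hτ
  change 1 - 12 * d * |τ| ≤ N ((1 + τ) * Real.exp u) / N (Real.exp u) ∧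
    N ((1 + τ) * Real.exp u) / N (Real.exp u) ≤ 1 + 12 * d * |τ|
  have hN0 := Npos _ hpos.le
  have hτ1 : |τ| ≤ 1 / 12 := by
    have := abs_nonneg τ
    nlinarith
  have hτ2 := abs_le.1 hτ1
  have h1τ : 0 < 1 + τ := by linarith
  have hexp : Real.exp (u + Real.log (1 + τ)) = (1 + τ) * Real.exp u := by
    rw [Real.exp_add, Real.exp_log h1τ, mul_comm]
  have hN1 := Npos ((1 + τ) * Real.exp u) (by positivity)
  rw [le_div_iff₀ hN0, div_le_iff₀ hN0]
  rcases le_total 0 τ with h | h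
  · rw [abs_of_nonneg h] at hτ' ⊢
    have hm := Nmono (Real.exp u) ((1 + τ) * Real.exp u) (by nlinarith)
    constructor
    · nlinarith [mul_nonneg (mul_nonneg (by linarith : 0 ≤ d) h) hN0.le]
    have hl0 : 0 ≤ Real.log (1 + τ) := Real.log_nonneg (by linarith)
    have hl1 : Real.log (1 + τ) ≤ Real.log 2 := Real.log_le_log h1τ (by linarith)
    have hl2 : Real.log (1 + τ) ≤ τ := by linarith [Real.log_le_sub_one_of_pos h1τ]
    have := hup (u + Real.log (1 + τ)) ⟨by linarith, by linarith [hu.2]⟩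
    simp only [hφ, hexp] at this
    have h3 : Real.log (N ((1 + τ) * Real.exp u)) ≤
        2 / 3 * (12 * d * τ) + Real.log (N (Real.exp u)) := by nlinarith
    have h4 := Real.exp_le_exp.2 h3
    rw [Real.exp_add, Real.exp_log hN0, Real.exp_log hN1] at h4
    exact h4.trans (mul_le_mul_of_nonneg_right (exp_two_thirds_le (by positivity) hτ') hN0.le)
  · rw [abs_of_nonpos h] at hτ' ⊢
    have hm := Nmono ((1 + τ) * Real.exp u) (Real.exp u) (by nlinarith)
    constructor
    · have hl0 : Real.log (1 + τ) ≤ 0 := Real.log_nonpos h1τ.le (by linarith)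
      have hl1 : -Real.log 2 ≤ Real.log (1 + τ) := by
        rw [← Real.log_inv]; exact Real.log_le_log (by norm_num) (by linarith)
      have hl2 : 12 / 11 * τ ≤ Real.log (1 + τ) := by
        have := Real.one_sub_inv_le_log_of_pos h1τ
        refine le_trans ?_ this
        rw [← sub_nonneg]
        have : 1 - (1 + τ)⁻¹ - 12 / 11 * τ = (-τ) * (1 / 11 + 12 / 11 * τ) / (1 + τ) := by
          field_simp; ring
        rw [this]
        exact div_nonneg (mul_nonneg (by linarith) (by linarith)) h1τ.le
      have := hdown (u + Real.log (1 + τ)) ⟨by linarith [hu.1], by linarith⟩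
      simp only [hφ, hexp] at this
      have h3 : 8 * d * Real.log (1 + τ) + Real.log (N (Real.exp u)) ≤
        Real.log (N ((1 + τ) * Real.exp u)) := by nlinarith
      have h4 := Real.exp_le_exp.2 h3
      rw [Real.exp_add, Real.exp_log hN0, Real.exp_log hN1] at h4
      refine le_trans (mul_le_mul_of_nonneg_right ?_ hN0.le) h4
      have h5 := Real.add_one_le_exp (8 * d * Real.log (1 + τ))
      nlinarith
    · nlinarith [mul_nonneg (mul_nonneg (by linarith : 0 ≤ d) (by linarith : 0 ≤ -τ)) hN0.le]

end Regular

/-! ### Riesz products and Chang's theorem relative to a weight. -/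

section Chang
set_option linter.unusedSectionVars false
variable {G : Type*} [AddCommGroup G] [Fintype G] [DecidableEq G]

lemma norm_prod_sub_one_le {ι : Type*} (s : Finset ι) (z : ι → ℂ) (hz : ∀ i ∈ s, ‖z i‖ = 1) :
    ‖∏ i ∈ s, z i - 1‖ ≤ ∑ i ∈ s, ‖z i - 1‖ := by
  classical
  induction s using Finset.induction_on with
  | empty => simp
  | insert a s ha ih =>
    rw [Finset.prod_insert ha, Finset.sum_insert ha]
    have h : z a * ∏ i ∈ s, z i - 1 = z a * (∏ i ∈ s, z i - 1) + (z a - 1) := by ring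
    rw [h, add_comm]
    refine (norm_add_le _ _).trans (add_le_add le_rfl ?_)
    rw [norm_mul, hz a (Finset.mem_insert_self a s), one_mul]
    exact ih fun i hi => hz i (Finset.mem_insert_of_mem hi)

lemma norm_zpow_sub_one_eq {z : ℂ} (hz : ‖z‖ = 1) {j : ℤ} (hj : j = -1 ∨ j = 1) :
    ‖z ^ j - 1‖ = ‖z - 1‖ := by
  rcases hj with rfl | rfl
  · have h0 : z ≠ 0 := by rintro rfl; simp at hz
    have h : z - 1 = -z * (z ^ (-1 : ℤ) - 1) := by
      rw [zpow_neg_one]; field_simp; ring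
    rw [h, norm_mul, norm_neg, hz, one_mul]
  · simp

/-- The exponent vectors with entries in `{-1, 0, 1}` supported on `Λ`. -/
noncomputable def signVectors (Λ : Finset (AddChar G ℂ)) : Finset (AddChar G ℂ → ℤ) := by
  classical
  exact Fintype.piFinset fun γ => if γ ∈ Λ then {-1, 0, 1} else {0}

lemma mem_signVectors {Λ : Finset (AddChar G ℂ)} {e : AddChar G ℂ → ℤ} :
    e ∈ signVectors Λ ↔ ∀ γ, (γ ∈ Λ → e γ = -1 ∨ e γ = 0 ∨ e γ = 1) ∧ (γ ∉ Λ → e γ = 0) := by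
  classical
  rw [signVectors, Fintype.mem_piFinset]
  refine forall_congr' fun γ => ?_
  by_cases h : γ ∈ Λ <;> simp [h]

/-- The character `∏ γ ^ e(γ)`. -/
noncomputable def charCombo (e : AddChar G ℂ → ℤ) : AddChar G ℂ := ∏ γ, γ ^ e γ

lemma charCombo_apply (e : AddChar G ℂ → ℤ) (x : G) : charCombo e x = ∏ γ, γ x ^ e γ := by
  simp [charCombo, AddChar.prod_apply]

/-- `Λ` is dissociated relative to the weight `β`, at level `2 ^ (-n)`. -/
def DissociatedRel (β : G → ℝ) (n : ℕ) (Λ : Finset (AddChar G ℂ)) : Prop :=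
  ∀ e ∈ signVectors Λ, e ≠ 0 → ‖ft β (charCombo e)‖ ≤ (2 ^ n)⁻¹

/-- The mean of a Riesz product over a relatively dissociated set is at most `2`. -/
lemma riesz_product_le {β : G → ℝ} {n : ℕ} {Λ : Finset (AddChar G ℂ)} (hβ1 : ∑ x, β x = 1)
    (hΛ : DissociatedRel β n Λ) (hcard : Λ.card ≤ n) {θ : ℝ} (hθ0 : 0 ≤ θ) (hθ1 : θ ≤ 1)
    {ω : AddChar G ℂ → ℂ} (hω : ∀ γ, ‖ω γ‖ ≤ 1) :
    ∑ x, β x * ∏ γ ∈ Λ, (1 + θ * (ω γ * γ x).re) ≤ 2 := by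
  classical
  set c : AddChar G ℂ → ℤ → ℂ := fun γ j =>
    if j = 0 then 1 else if j = 1 then θ / 2 * ω γ else θ / 2 * (starRingEnd ℂ) (ω γ) with hc
  set t : AddChar G ℂ → Finset ℤ := fun γ => if γ ∈ Λ then {-1, 0, 1} else {0} with ht
  have ht' : signVectors Λ = Fintype.piFinset t := by
    ext e; rw [mem_signVectors, Fintype.mem_piFinset]
    refine forall_congr' fun γ => ?_
    by_cases h : γ ∈ Λ <;> simp [h, ht]
  have hexpand : ∀ x, ((∏ γ ∈ Λ, (1 + θ * (ω γ * γ x).re) : ℝ) : ℂ)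
      = ∑ e ∈ signVectors Λ, (∏ γ, c γ (e γ)) * charCombo e x := by
    intro x
    simp_rw [charCombo_apply, ← Finset.prod_mul_distrib]
    rw [ht', ← Finset.prod_univ_sum t (fun γ j => c γ j * γ x ^ j)]
    rw [Complex.ofReal_prod, ← Finset.prod_subset (Finset.subset_univ Λ)
      (fun γ _ hγ => by simp [ht, hγ, hc])]
    refine Finset.prod_congr rfl fun γ hγ => ?_
    have h1 : γ x ^ (-1 : ℤ) = (starRingEnd ℂ) (γ x) := by
      rw [zpow_neg_one, ← AddChar.map_neg_eq_inv, AddChar.map_neg_eq_conj]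
    have h2 : ((ω γ * γ x).re : ℂ) = (ω γ * γ x + (starRingEnd ℂ) (ω γ * γ x)) / 2 := by
      rw [Complex.add_conj]; push_cast; ring
    simp only [ht, hγ, if_true]
    rw [Finset.sum_insert (by simp), Finset.sum_insert (by simp), Finset.sum_singleton, h1]
    simp only [hc]
    push_cast
    rw [h2, map_mul]
    norm_num
    ring
  -- Each factor of the Riesz product has coefficient mass at most 1 + θ ≤ 2. The total 2^n is
  -- exactly offset by the dissociation level 2^{-n}, so the nonconstant terms contribute at most 1.
  have hnormc : ∑ e ∈ signVectors Λ, ∏ γ, ‖c γ (e γ)‖ ≤ 2 ^ n := by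
    rw [ht', ← Finset.prod_univ_sum t (fun γ j => ‖c γ j‖),
      ← Finset.prod_subset (Finset.subset_univ Λ) (fun γ _ hγ => by simp [ht, hγ, hc])]
    calc ∏ γ ∈ Λ, ∑ j ∈ t γ, ‖c γ j‖ ≤ ∏ γ ∈ Λ, (2 : ℝ) := by
          refine Finset.prod_le_prod (fun _ _ => Finset.sum_nonneg fun _ _ => norm_nonneg _)
            fun γ hγ => ?_
          simp only [ht, hγ, if_true]
          rw [Finset.sum_insert (by simp), Finset.sum_insert (by simp), Finset.sum_singleton]
          have := mul_le_mul hθ1 (hω γ) (norm_nonneg _) (by norm_num)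
          simp [hc, abs_of_nonneg hθ0]
          linarith
      _ = 2 ^ Λ.card := by simp
      _ ≤ 2 ^ n := pow_le_pow_right₀ (by norm_num) hcard
  have hsum : ((∑ x, β x * ∏ γ ∈ Λ, (1 + θ * (ω γ * γ x).re) : ℝ) : ℂ)
      = ∑ e ∈ signVectors Λ, (∏ γ, c γ (e γ)) * ft β (charCombo e) := by
    rw [Complex.ofReal_sum]
    simp_rw [Complex.ofReal_mul, hexpand, ft, Finset.mul_sum]
    rw [Finset.sum_comm]
    refine Finset.sum_congr rfl fun e _ => Finset.sum_congr rfl fun x _ => by ring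
  have h0 : (0 : AddChar G ℂ → ℤ) ∈ signVectors Λ := by
    rw [mem_signVectors]; intro γ; simp
  have hft0 : ft β (charCombo 0) = 1 := by
    simp only [ft, charCombo]
    simp only [Pi.zero_apply, zpow_zero, Finset.prod_const_one, AddChar.one_apply, mul_one]
    exact_mod_cast hβ1
  calc ∑ x, β x * ∏ γ ∈ Λ, (1 + θ * (ω γ * γ x).re)
      ≤ ‖((∑ x, β x * ∏ γ ∈ Λ, (1 + θ * (ω γ * γ x).re) : ℝ) : ℂ)‖ := by
        rw [Complex.norm_real]; exact Real.le_norm_self _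
    _ ≤ ∑ e ∈ signVectors Λ, (∏ γ, ‖c γ (e γ)‖) * ‖ft β (charCombo e)‖ := by
        rw [hsum]
        refine (norm_sum_le _ _).trans (le_of_eq (Finset.sum_congr rfl fun e _ => ?_))
        rw [norm_mul, norm_prod]
    _ = 1 + ∑ e ∈ (signVectors Λ).erase 0, (∏ γ, ‖c γ (e γ)‖) * ‖ft β (charCombo e)‖ := by
        rw [← Finset.add_sum_erase _ _ h0, hft0]
        simp [hc]
    _ ≤ 1 + ∑ e ∈ (signVectors Λ).erase 0, (∏ γ, ‖c γ (e γ)‖) * (2 ^ n)⁻¹ := by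
        refine add_le_add le_rfl (Finset.sum_le_sum fun e he => ?_)
        rw [Finset.mem_erase] at he
        exact mul_le_mul_of_nonneg_left (hΛ e he.2 he.1)
          (Finset.prod_nonneg fun _ _ => norm_nonneg _)
    _ ≤ 1 + ∑ e ∈ signVectors Λ, (∏ γ, ‖c γ (e γ)‖) * (2 ^ n)⁻¹ := by
        refine add_le_add le_rfl (Finset.sum_le_sum_of_subset_of_nonneg (Finset.erase_subset _ _)
          fun e _ _ => ?_)
        exact mul_nonneg (Finset.prod_nonneg fun _ _ => norm_nonneg _) (by positivity)
    _ ≤ 1 + 2 ^ n * (2 ^ n)⁻¹ := by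
        rw [← Finset.sum_mul]; gcongr
    _ = 2 := by rw [mul_inv_cancel₀ (by positivity)]; norm_num

/-- The chord of exp over [-1/2, 1/2] is cosh(1/2)(1 + tanh(1/2) y), and cosh(1/2) ≤ e^{1/8}. This
dominates an exponential of a sum by a Riesz product. -/
lemma exp_half_le {y : ℝ} (hy : |y| ≤ 1) :
    Real.exp (y / 2) ≤ Real.exp (1 / 8) * (1 + Real.tanh (1 / 2) * y) := by
  have hy' := abs_le.1 hy
  have hconv := convexOn_exp.2 (Set.mem_univ (1 / 2 : ℝ)) (Set.mem_univ (-(1 / 2) : ℝ))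
    (show 0 ≤ (1 + y) / 2 by linarith) (show 0 ≤ (1 - y) / 2 by linarith) (by ring)
  simp only [smul_eq_mul] at hconv
  rw [show (1 + y) / 2 * (1 / 2) + (1 - y) / 2 * (-(1 / 2)) = y / 2 by ring] at hconv
  have hcpos := Real.cosh_pos (1 / 2)
  have h1 : (1 + y) / 2 * Real.exp (1 / 2) + (1 - y) / 2 * Real.exp (-(1 / 2))
      = Real.cosh (1 / 2) * (1 + Real.tanh (1 / 2) * y) := by
    rw [Real.tanh_eq_sinh_div_cosh, mul_add, ← mul_assoc, mul_div_cancel₀ _ hcpos.ne',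
      Real.cosh_eq, Real.sinh_eq]; ring
  have h2 : Real.cosh (1 / 2) ≤ Real.exp (1 / 8) := by
    refine (Real.cosh_le_exp_half_sq _).trans (le_of_eq ?_); norm_num
  have h3 := Real.exp_pos (y / 2)
  rw [h1] at hconv
  have h4 : 0 ≤ 1 + Real.tanh (1 / 2) * y := by
    by_contra hcon
    have := mul_neg_of_pos_of_neg hcpos (not_le.1 hcon)
    linarith
  exact hconv.trans (mul_le_mul_of_nonneg_right h2 h4)

/-- Relatively dissociated subsets of the large spectrum are small. -/
lemma card_le_of_dissociatedRel {β : G → ℝ} {n : ℕ} {Λ : Finset (AddChar G ℂ)}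
    (hβ0 : ∀ x, 0 ≤ β x) (hβ1 : ∑ x, β x = 1)
    (hΛ : DissociatedRel β n Λ) (hcard : Λ.card ≤ n) {T : Finset G} (hT : T.Nonempty) {D : ℝ}
    (hD : ∀ x, unif T x ≤ D * β x) (hspec : ∀ γ ∈ Λ, 1 / 2 ≤ ‖ft (unif T) γ‖) :
    (Λ.card : ℝ) ≤ 8 * Real.log (2 * D) := by
  -- The phases align the coefficients of μ_T, so that Y has mean at least |Λ|/2 on T.
  set ω : AddChar G ℂ → ℂ := fun γ =>
    (starRingEnd ℂ) (ft (unif T) γ) / ‖ft (unif T) γ‖ with hωdef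
  have hω : ∀ γ, ‖ω γ‖ ≤ 1 := by
    intro γ
    simp only [hωdef, norm_div, RCLike.norm_conj, Complex.norm_real, norm_norm]
    exact div_self_le_one _
  set Y : G → ℝ := fun x => ∑ γ ∈ Λ, (ω γ * γ x).re with hY
  have hy1 : ∀ γ x, |(ω γ * γ x).re| ≤ 1 := by
    intro γ x
    refine (Complex.abs_re_le_norm _).trans ?_
    rw [norm_mul, AddChar.norm_apply, mul_one]; exact hω γ
  have hmean : (Λ.card : ℝ) / 2 ≤ ∑ x, unif T x * Y x := by
    have h1 : ∑ x, unif T x * Y x = ∑ γ ∈ Λ, ∑ x, unif T x * (ω γ * γ x).re := by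
      simp only [hY, Finset.mul_sum]; rw [Finset.sum_comm]
    rw [h1]
    have h2 : (Λ.card : ℝ) / 2 = ∑ γ ∈ Λ, (1 / 2 : ℝ) := by simp; ring
    rw [h2]
    refine Finset.sum_le_sum fun γ hγ => ?_
    have h3 : ∑ x, unif T x * (ω γ * γ x).re = (ω γ * ft (unif T) γ).re := by
      rw [ft, Finset.mul_sum, Complex.re_sum]
      refine Finset.sum_congr rfl fun x _ => ?_
      rw [mul_left_comm, Complex.re_ofReal_mul]
    have h4 : ω γ * ft (unif T) γ = (‖ft (unif T) γ‖ : ℂ) := by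
      have h5 : ‖ft (unif T) γ‖ ≠ 0 := by have := hspec γ hγ; intro h; rw [h] at this; norm_num at this
      have h6 : (‖ft (unif T) γ‖ : ℂ) ≠ 0 := by exact_mod_cast h5
      simp only [hωdef]
      rw [div_mul_eq_mul_div, mul_comm, Complex.mul_conj', sq, mul_div_assoc, div_self h6, mul_one]
    rw [h3, h4, Complex.ofReal_re]
    exact hspec γ hγ
  set a := (Λ.card : ℝ) / 4 with ha
  -- Jensen's inequality by the tangent line of exp at a = |Λ|/4.
  have hjensen : Real.exp a ≤ ∑ x, unif T x * Real.exp (Y x / 2) := by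
    calc Real.exp a ≤ Real.exp a * (1 + (∑ x, unif T x * Y x) / 2 - a) := by
          have := Real.exp_pos a
          nlinarith
      _ = ∑ x, unif T x * (Real.exp a * (1 + Y x / 2 - a)) := by
          have h1 : ∀ x, unif T x * (Real.exp a * (1 + Y x / 2 - a))
            = Real.exp a * (1 - a) * unif T x + Real.exp a / 2 * (unif T x * Y x) := by
            intro x; ring
          simp_rw [h1]
          rw [Finset.sum_add_distrib, ← Finset.mul_sum, ← Finset.mul_sum, sum_unif hT]
          ring
      _ ≤ _ := by
          refine Finset.sum_le_sum fun x _ => mul_le_mul_of_nonneg_left ?_ (unif_nonneg T x)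
          have h1 := Real.add_one_le_exp (Y x / 2 - a)
          have h2 : Real.exp (Y x / 2) = Real.exp a * Real.exp (Y x / 2 - a) := by
            rw [← Real.exp_add]; ring_nf
          rw [h2]
          exact mul_le_mul_of_nonneg_left (by linarith) (Real.exp_pos a).le
  have hDpos : 0 ≤ D := by
    obtain ⟨x, hx⟩ := hT
    have h1 := hD x
    have h2 : 0 < unif T x := by
      simp only [unif, ind, hx, if_true]
      have := Finset.card_pos.2 ⟨x, hx⟩
      positivity
    by_contra hcon
    have := mul_nonpos_of_nonpos_of_nonneg (not_le.1 hcon).le (hβ0 x)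
    linarith
  have hth0 : 0 ≤ Real.tanh (1 / 2) := by
    rw [Real.tanh_eq_sinh_div_cosh]
    exact div_nonneg (Real.sinh_nonneg_iff.2 (by norm_num)) (Real.cosh_pos _).le
  have hth1 : Real.tanh (1 / 2) ≤ 1 := (Real.tanh_lt_one _).le
  -- The Riesz product bounds the same exponential moment by 2D e^{|Λ|/8}; comparison with e^{|Λ|/4}
  -- leaves |Λ|/8 ≤ log(2D).
  have hmain : Real.exp a ≤ D * (Real.exp (1 / 8) ^ Λ.card * 2) := by
    calc Real.exp a ≤ ∑ x, unif T x * Real.exp (Y x / 2) := hjensen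
      _ ≤ ∑ x, D * (Real.exp (1 / 8) ^ Λ.card *
            (β x * ∏ γ ∈ Λ, (1 + Real.tanh (1 / 2) * (ω γ * γ x).re))) := by
          refine Finset.sum_le_sum fun x _ => ?_
          have h1 : Real.exp (Y x / 2) ≤ Real.exp (1 / 8) ^ Λ.card *
              ∏ γ ∈ Λ, (1 + Real.tanh (1 / 2) * (ω γ * γ x).re) := by
            simp only [hY, Finset.sum_div]
            rw [Real.exp_sum, ← Finset.prod_const, ← Finset.prod_mul_distrib]
            exact Finset.prod_le_prod (fun _ _ => (Real.exp_pos _).le)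
              fun γ _ => exp_half_le (hy1 γ x)
          calc unif T x * Real.exp (Y x / 2) ≤ (D * β x) * (Real.exp (1 / 8) ^ Λ.card *
              ∏ γ ∈ Λ, (1 + Real.tanh (1 / 2) * (ω γ * γ x).re)) :=
                mul_le_mul (hD x) h1 (Real.exp_pos _).le (mul_nonneg hDpos (hβ0 x))
            _ = _ := by ring
      _ = D * (Real.exp (1 / 8) ^ Λ.card *
            ∑ x, β x * ∏ γ ∈ Λ, (1 + Real.tanh (1 / 2) * (ω γ * γ x).re)) := by
          rw [Finset.mul_sum, Finset.mul_sum]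
      _ ≤ _ := by
          refine mul_le_mul_of_nonneg_left (mul_le_mul_of_nonneg_left ?_ (by positivity)) hDpos
          exact riesz_product_le hβ1 hΛ hcard hth0 hth1 hω
  rw [← Real.exp_nat_mul] at hmain
  have h2D : 0 < 2 * D := by
    rcases hDpos.eq_or_lt with h | h
    · rw [← h] at hmain; have := Real.exp_pos a; linarith
    · linarith
  have h5 := Real.log_le_log (Real.exp_pos a) (hmain.trans (le_of_eq (by ring :
    D * (Real.exp (Λ.card * (1 / 8)) * 2) = (2 * D) * Real.exp (Λ.card * (1 / 8)))))
  rw [Real.log_mul h2D.ne' (Real.exp_pos _).ne', Real.log_exp, Real.log_exp] at h5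
  rw [ha] at h5
  linarith

/-- The large spectrum is controlled by few of its elements and the large spectrum of `β`. -/
lemma exists_spectrum_control {β : G → ℝ} {n : ℕ} (hβ0 : ∀ x, 0 ≤ β x) (hβ1 : ∑ x, β x = 1)
    {T : Finset G} (hT : T.Nonempty) {D : ℝ} (hD : ∀ x, unif T x ≤ D * β x) (hn1 : 1 ≤ n)
    (hn : 8 * Real.log (2 * D) < n) :
    ∃ Λ : Finset (AddChar G ℂ), Λ.card ≤ n ∧ ∀ (t : G) (a b : ℝ), 0 ≤ a → 0 ≤ b →
      (∀ χ : AddChar G ℂ, (2 ^ n)⁻¹ < ‖ft β χ‖ → ‖χ t - 1‖ ≤ a) →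
      (∀ γ ∈ Λ, ‖γ t - 1‖ ≤ b) →
      ∀ γ : AddChar G ℂ, 1 / 2 ≤ ‖ft (unif T) γ‖ → ‖γ t - 1‖ ≤ a + n * b := by
  classical
  set P : Finset (AddChar G ℂ) → Prop := fun Λ =>
    (∀ γ ∈ Λ, 1 / 2 ≤ ‖ft (unif T) γ‖) ∧ DissociatedRel β n Λ ∧ Λ.card ≤ n with hP
  have hPempty : P ∅ := by
    refine ⟨by simp, fun e he h0 => ?_, by simp⟩
    exact absurd (funext fun γ => ((mem_signVectors.1 he) γ).2 (by simp)) h0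
  -- Take a maximal dissociated subset of the spectrum. Its size is strictly below n, so adjoining
  -- another spectral character keeps the size admissible and must destroy dissociation.
  obtain ⟨Λ, hΛmem, hΛmax⟩ := Finset.exists_max_image (Finset.univ.filter P) Finset.card
    ⟨∅, by simp [hPempty]⟩
  obtain ⟨hspec, hdis, hcard⟩ : P Λ := (Finset.mem_filter.1 hΛmem).2
  have hlt : Λ.card < n := by
    have := (card_le_of_dissociatedRel hβ0 hβ1 hdis hcard hT hD hspec).trans_lt hn
    exact_mod_cast this
  refine ⟨Λ, hcard, fun t a b ha hb hχ hγb γ hγ => ?_⟩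
  have hnR : (1 : ℝ) ≤ n := by exact_mod_cast hn1
  by_cases hmem : γ ∈ Λ
  · have := hγb γ hmem
    nlinarith
  have hnot : ¬ P (insert γ Λ) := by
    intro h
    have := hΛmax _ (Finset.mem_filter.2 ⟨Finset.mem_univ _, h⟩)
    rw [Finset.card_insert_of_notMem hmem] at this
    omega
  have hnd : ¬ DissociatedRel β n (insert γ Λ) := by
    intro h
    refine hnot ⟨?_, h, ?_⟩
    · intro χ hχ
      rcases Finset.mem_insert.1 hχ with rfl | h'
      · exact hγ
      · exact hspec χ h'
    · rw [Finset.card_insert_of_notMem hmem]; omega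
  unfold DissociatedRel at hnd
  push Not at hnd
  obtain ⟨e, he, he0, hbig⟩ := hnd
  rw [mem_signVectors] at he
  -- The violating relation must involve γ, otherwise it would violate the dissociation of Λ; it
  -- then expresses γ^{±1} through Λ and a character in the large spectrum of β.
  have heγ : e γ = -1 ∨ e γ = 1 := by
    rcases (he γ).1 (Finset.mem_insert_self _ _) with h | h | h
    · exact Or.inl h
    · exfalso
      refine absurd (hdis e ?_ he0) (not_le.2 hbig)
      rw [mem_signVectors]
      intro χ
      refine ⟨fun h' => (he χ).1 (Finset.mem_insert_of_mem h'), fun h' => ?_⟩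
      by_cases hχγ : χ = γ
      · rw [hχγ, h]
      · exact (he χ).2 (by simp [hχγ, h'])
    · exact Or.inr h
  have h1 := hχ _ hbig
  rw [charCombo_apply, ← Finset.mul_prod_erase _ _ (Finset.mem_univ γ)] at h1
  set Q := ∏ χ ∈ Finset.univ.erase γ, χ t ^ e χ with hQ
  have hnorm : ∀ (χ : AddChar G ℂ) (j : ℤ), ‖χ t ^ j‖ = 1 := by
    intro χ j; rw [norm_zpow, AddChar.norm_apply, one_zpow]
  have hQ1 : ‖Q‖ = 1 := by
    rw [hQ, norm_prod]; exact Finset.prod_eq_one fun χ _ => hnorm χ _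
  have hQ2 : ‖Q - 1‖ ≤ n * b := by
    refine (norm_prod_sub_one_le _ _ fun χ _ => hnorm χ _).trans ?_
    have hsub : Λ ⊆ Finset.univ.erase γ := fun χ hχ => by
      rw [Finset.mem_erase]; exact ⟨fun h => hmem (h ▸ hχ), Finset.mem_univ _⟩
    rw [← Finset.sum_subset hsub fun χ hχ1 hχ2 => by
      have : e χ = 0 := (he χ).2 (by simp [Finset.ne_of_mem_erase hχ1, hχ2])
      simp [this]]
    calc ∑ χ ∈ Λ, ‖χ t ^ e χ - 1‖ ≤ ∑ χ ∈ Λ, b := by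
          refine Finset.sum_le_sum fun χ hχ => ?_
          have hz : ‖χ t‖ = 1 := AddChar.norm_apply _ _
          rcases (he χ).1 (Finset.mem_insert_of_mem hχ) with h | h | h
          · rw [norm_zpow_sub_one_eq hz (Or.inl h)]; exact hγb χ hχ
          · simp [h, hb]
          · rw [norm_zpow_sub_one_eq hz (Or.inr h)]; exact hγb χ hχ
      _ = Λ.card * b := by simp
      _ ≤ n * b := by gcongr
  rw [← norm_zpow_sub_one_eq (AddChar.norm_apply γ t) heγ]
  have h2 : ‖γ t ^ e γ - 1‖ = ‖(γ t ^ e γ * Q - 1) - (Q - 1)‖ := by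
    have : (γ t ^ e γ * Q - 1) - (Q - 1) = (γ t ^ e γ - 1) * Q := by ring
    rw [this, norm_mul, hQ1, mul_one]
  rw [h2]
  exact (norm_sub_le _ _).trans (add_le_add h1 hQ2)

end Chang

/-! ### Smooth weights on Bohr sets and Chang's theorem relative to a Bohr set. -/

section Smoothing
set_option linter.unusedSectionVars false
variable {G : Type*} [AddCommGroup G] [Fintype G] [DecidableEq G]

lemma conv_unif_apply (X : Finset G) (u : G → ℝ) (x : G) :
    conv (unif X) u x = (∑ y ∈ X, u (x - y)) / X.card :=
  sum_unif_mul X fun y => u (x - y)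

lemma conv_unif_nonneg (X : Finset G) {u : G → ℝ} (hu : ∀ x, 0 ≤ u x) (x : G) :
    0 ≤ conv (unif X) u x :=
  Finset.sum_nonneg fun _ _ => mul_nonneg (unif_nonneg _ _) (hu _)

lemma sum_conv (u w : G → ℝ) : ∑ x, conv u w x = (∑ x, u x) * ∑ x, w x := by
  unfold conv
  rw [Finset.sum_comm, Finset.sum_mul]
  refine Finset.sum_congr rfl fun y _ => ?_
  rw [← Finset.mul_sum]
  congr 1
  exact Fintype.sum_equiv (Equiv.subRight y) _ _ fun x => rfl

lemma iterate_conv_unif_nonneg (X : Finset G) {u : G → ℝ} (hu : ∀ x, 0 ≤ u x) (n : ℕ) (x : G) :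
    0 ≤ (conv (unif X))^[n] u x := by
  induction n generalizing x with
  | zero => exact hu x
  | succ n ih => rw [Function.iterate_succ_apply']; exact conv_unif_nonneg X ih x

lemma sum_iterate_conv_unif {X : Finset G} (hX : X.Nonempty) (u : G → ℝ) (n : ℕ) :
    ∑ x, (conv (unif X))^[n] u x = ∑ x, u x := by
  induction n with
  | zero => rfl
  | succ n ih => rw [Function.iterate_succ_apply', sum_conv, sum_unif hX, ih, one_mul]

lemma ft_iterate_conv (w u : G → ℝ) (n : ℕ) (γ : AddChar G ℂ) :
    ft ((conv w)^[n] u) γ = ft w γ ^ n * ft u γ := by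
  induction n with
  | zero => simp
  | succ n ih => rw [Function.iterate_succ_apply', ft_conv, ih]; ring

/-- Averages over a Bohr set do not change the uniform weight of a larger Bohr set well inside
the latter. -/
lemma iterate_conv_unif_bohr {Γ : Finset (AddChar G ℂ)} {σ s : ℝ} (hσ : 0 ≤ σ) (n : ℕ) {x : G}
    (hx : x ∈ bohr Γ (s - n * σ)) :
    (conv (unif (bohrFin Γ σ)))^[n] (unif (bohrFin Γ s)) x = 1 / (bohrFin Γ s).card := by
  induction n generalizing x with
  | zero =>
    have h : x ∈ bohrFin Γ s := by simpa using hx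
    simp [unif, ind, h]
  | succ n ih =>
    rw [Function.iterate_succ_apply', conv_unif_apply]
    have hne : ((bohrFin Γ σ).card : ℝ) ≠ 0 := by
      rw [card_bohrFin]; exact_mod_cast (ncard_bohr_pos Γ hσ).ne'
    rw [Finset.sum_congr rfl (g := fun _ => 1 / ((bohrFin Γ s).card : ℝ))]
    · rw [Finset.sum_const, nsmul_eq_mul, mul_div_cancel_left₀ _ hne]
    · intro y hy
      refine ih ?_
      have := add_mem_bohr hx (neg_mem_bohr (mem_bohrFin.1 hy))
      rw [← sub_eq_add_neg] at this
      refine bohr_mono Γ (le_of_eq ?_) this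
      push_cast; ring

/-- A character at which the transform of a regular Bohr set is large is almost constant on small
dilates. -/
lemma norm_char_sub_one_le {X : BohrSet G} (hX : X.IsRegular) {χ : AddChar G ℂ}
    (hχ : 1 / 2 ≤ ‖ft (unif (bohrFin X.freqs X.radius)) χ‖) {τ : ℝ} (hτ0 : 0 ≤ τ)
    (hτ1 : 12 * (X.rank : ℝ) * τ ≤ 1) {t : G} (ht : t ∈ X.dilate τ) :
    ‖χ t - 1‖ ≤ 48 * (X.rank : ℝ) * τ := by
  set F := bohrFin X.freqs X.radius with hF
  set F' := bohrFin X.freqs ((1 - τ) * X.radius) with hF'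
  have hcard : (0 : ℝ) < F.card := by
    rw [hF, card_bohrFin]; exact_mod_cast ncard_bohr_pos _ X.radius_nonneg
  have hreg : 1 - 12 * (X.rank : ℝ) * τ ≤ F'.card / F.card := by
    have h := (hX (-τ) (by rwa [abs_neg, abs_of_nonneg hτ0])).1
    rw [abs_neg, abs_of_nonneg hτ0] at h
    rw [hF, hF', card_bohrFin, card_bohrFin]
    rwa [← sub_eq_add_neg] at h
  have hFF' : ∀ x ∈ F', x ∈ F ∧ x + -t ∈ F := by
    intro x hx
    rw [hF', mem_bohrFin] at hx
    rw [hF, mem_bohrFin, mem_bohrFin]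
    have h1 := add_mem_bohr hx (neg_mem_bohr ht)
    have hr := mul_nonneg hτ0 X.radius_nonneg
    exact ⟨bohr_mono _ (by linarith) hx, bohr_mono _ (le_of_eq (by ring)) h1⟩
  -- The product is the transform of the difference of two translates of μ_B. They agree on the
  -- dilate by 1 - τ, so regularity bounds the ℓ¹ norm by 24dτ; dividing by 1/2 gives 48dτ.
  have hkey : (χ t - 1) * ft (unif F) χ
      = ∑ x, ((unif F (x + -t) - unif F x : ℝ) : ℂ) * χ x := by
    have h1 := ft_shift (unif F) (-t) χ
    rw [neg_neg] at h1
    rw [sub_mul, ← h1, one_mul, ft, ft, ← Finset.sum_sub_distrib]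
    refine Finset.sum_congr rfl fun x _ => ?_
    push_cast; ring
  have hbound : ‖(χ t - 1) * ft (unif F) χ‖ ≤ 24 * (X.rank : ℝ) * τ := by
    rw [hkey]
    calc _ ≤ ∑ x, |unif F (x + -t) - unif F x| := by
          refine (norm_sum_le _ _).trans (le_of_eq (Finset.sum_congr rfl fun x _ => ?_))
          rw [norm_mul, AddChar.norm_apply, mul_one, Complex.norm_real, Real.norm_eq_abs]
      _ ≤ ∑ x, (unif F (x + -t) + unif F x - 2 * (ind F' x / F.card)) := by
          refine Finset.sum_le_sum fun x _ => ?_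
          by_cases hx : x ∈ F'
          · simp [unif, ind, hFF' x hx, hx]; ring_nf; simp
          · have h1 := unif_nonneg F (x + -t)
            have h2 := unif_nonneg F x
            simp only [ind, hx, if_false, zero_div, mul_zero, sub_zero]
            rw [abs_le]; constructor <;> linarith
      _ = 2 - 2 * (F'.card / F.card) := by
          have h1 : ∑ x, unif F (x + -t) = 1 := by
            rw [← sum_unif (Finset.card_pos.1 (by exact_mod_cast hcard : 0 < F.card))]
            exact Fintype.sum_equiv (Equiv.addRight (-t)) _ _ fun x => rfl
          rw [Finset.sum_sub_distrib, Finset.sum_add_distrib, h1,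
            sum_unif (Finset.card_pos.1 (by exact_mod_cast hcard : 0 < F.card)),
            ← Finset.mul_sum, ← Finset.sum_div]
          have h2 : ∑ x, ind F' x = F'.card := by simp [ind]
          rw [h2]; ring
      _ ≤ _ := by linarith
  rw [norm_mul] at hbound
  have := mul_le_mul_of_nonneg_left hχ (norm_nonneg (χ t - 1))
  linarith

/-- **Chang's theorem relative to a regular Bohr set.** -/
theorem chang_bohr {B : BohrSet G} (hB : B.IsRegular) (hrank : 1 ≤ B.rank) (hrad : B.radius ≤ 2)
    {T : Finset G} (hT : T.Nonempty) (hTB : (T : Set G) ⊆ B.carrier) {κ : ℝ} (hκ0 : 0 < κ)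
    (hκ1 : κ ≤ 1) {n : ℕ} (hn : 8 * Real.log (4 * (B.carrier.ncard / T.card)) < n) :
    ∃ Λ : Finset (AddChar G ℂ), Λ.card ≤ n ∧
      ∀ t : G, t ∈ bohr B.freqs (B.radius * κ / (73728 * B.rank ^ 2 * n)) →
        t ∈ bohr Λ (B.radius * κ / (73728 * B.rank ^ 2 * n)) →
        ∀ γ : AddChar G ℂ, 1 / 2 ≤ ‖ft (unif T) γ‖ → ‖γ t - 1‖ ≤ κ := by
  classical
  have hTpos : (0 : ℝ) < T.card := by exact_mod_cast hT.card_pos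
  have hBpos : (0 : ℝ) < B.carrier.ncard := by
    exact_mod_cast ncard_bohr_pos B.freqs B.radius_nonneg
  have hTle : (T.card : ℝ) ≤ B.carrier.ncard := by
    have := Set.ncard_le_ncard hTB (Set.toFinite _)
    rw [Set.ncard_coe_finset] at this; exact_mod_cast this
  have hn1 : 1 ≤ n := by
    have h1 : (1 : ℝ) ≤ 4 * (B.carrier.ncard / T.card) := by
      have := (one_le_div hTpos).2 hTle
      linarith
    have h2 := Real.log_nonneg h1
    have h3 : (0 : ℝ) < n := by linarith
    exact_mod_cast h3
  have hnR : (1 : ℝ) ≤ n := by exact_mod_cast hn1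
  set d : ℝ := (B.rank : ℝ) with hd
  have hd1 : 1 ≤ d := by rw [hd]; exact_mod_cast hrank
  have hρ := B.radius_nonneg
  set ρ := B.radius with hρdef
  -- The weight β averages n times over X, starting from a Bohr set of radius s slightly above ρ. As
  -- n · radius(X) ≤ ρ/(12d), β is constant on B, with value at least 1/(2|B|). The n-fold averaging
  -- places the 2^{-n}-spectrum of β inside the 1/2-spectrum of μ_X.
  obtain ⟨X, hXf, hX1, hX2, hXreg⟩ := exists_regular_dilate (Γ := B.freqs)
    (Finset.card_pos.1 hrank) (ρ := ρ / (12 * d * n)) (by positivity)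
  set s := ρ * (1 + 1 / (12 * d)) with hs
  set F := bohrFin B.freqs X.radius with hF
  set β := (conv (unif F))^[n] (unif (bohrFin B.freqs s)) with hβ
  have hs0 : 0 ≤ s := by positivity
  have hFne : F.Nonempty := ⟨0, by rw [hF, mem_bohrFin]; exact zero_mem_bohr _ X.radius_nonneg⟩
  have hSne : (bohrFin B.freqs s).Nonempty := ⟨0, by rw [mem_bohrFin]; exact zero_mem_bohr _ hs0⟩
  have hβ0 : ∀ x, 0 ≤ β x := fun x => iterate_conv_unif_nonneg F (unif_nonneg _) n x
  have hβ1 : ∑ x, β x = 1 := by rw [hβ, sum_iterate_conv_unif hFne, sum_unif hSne]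
  have hScard : ((bohrFin B.freqs s).card : ℝ) ≤ 2 * B.carrier.ncard := by
    have h0 : 12 * d * (1 / (12 * d)) = 1 := by field_simp
    have h := (hB (1 / (12 * d)) (by rw [abs_of_nonneg (by positivity)]; exact h0.le)).2
    rw [abs_of_nonneg (by positivity), h0, div_le_iff₀ hBpos] at h
    rw [card_bohrFin, hs, mul_comm]
    norm_num at h ⊢
    exact h
  have hD : ∀ x, unif T x ≤ 2 * (B.carrier.ncard / T.card) * β x := by
    intro x
    by_cases hx : x ∈ T
    · have hxB : x ∈ bohr B.freqs (s - n * X.radius) := by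
        refine bohr_mono _ ?_ (hTB hx)
        have h1 : n * X.radius ≤ n * (ρ / (12 * d * n)) := by gcongr
        have h2 : n * (ρ / (12 * d * n)) = ρ * (1 / (12 * d)) := by field_simp
        rw [hs]
        change ρ ≤ _
        linarith
      rw [hβ, hF, iterate_conv_unif_bohr X.radius_nonneg n hxB]
      have hSpos : (0 : ℝ) < (bohrFin B.freqs s).card := by exact_mod_cast hSne.card_pos
      simp only [unif, ind, hx, if_true]
      have h3 : 2 * (B.carrier.ncard / (T.card : ℝ)) * (1 / (bohrFin B.freqs s).card)
        = (1 / T.card) * (2 * B.carrier.ncard / (bohrFin B.freqs s).card) := by ring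
      rw [h3]
      have h4 := (one_le_div hSpos).2 hScard
      have h5 : (0 : ℝ) < 1 / T.card := by positivity
      nlinarith
    · have : unif T x = 0 := by simp [unif, ind, hx]
      rw [this]
      have := hβ0 x
      positivity
  obtain ⟨Λ, hΛ, hctrl⟩ := exists_spectrum_control hβ0 hβ1 hT hD hn1
    (by rwa [show 2 * (2 * (B.carrier.ncard / (T.card : ℝ)))
      = 4 * (B.carrier.ncard / T.card) by ring])
  refine ⟨Λ, hΛ, fun t htB htΛ γ hγ => ?_⟩
  set r := ρ * κ / (73728 * d ^ 2 * n) with hr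
  have hr0 : 0 ≤ r := by positivity
  have hmain := hctrl t (κ / 2) r (by positivity) hr0 ?_ htΛ γ hγ
  · have h1 : n * r ≤ κ / 2 := by
      have h2 : n * r = ρ * κ / (73728 * d ^ 2) := by rw [hr]; field_simp
      rw [h2, div_le_iff₀ (by positivity)]
      have h3 : 1 ≤ d ^ 2 := one_le_pow₀ hd1
      nlinarith [mul_le_mul hrad (le_refl κ) hκ0.le (by norm_num)]
    linarith
  · intro χ hχ
    rw [hβ, ft_iterate_conv, norm_mul, norm_pow] at hχ
    have hhalf : 1 / 2 ≤ ‖ft (unif F) χ‖ := by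
      by_contra hcon
      have h1 := pow_le_pow_left₀ (norm_nonneg _) (not_le.1 hcon).le n
      have h2 := norm_ft_unif_le_one (bohrFin B.freqs s) χ
      have h3 : ‖ft (unif F) χ‖ ^ n * ‖ft (unif (bohrFin B.freqs s)) χ‖ ≤ (1 / 2) ^ n * 1 :=
        mul_le_mul h1 h2 (norm_nonneg _) (by positivity)
      rw [mul_one, one_div, inv_pow] at h3
      linarith
    have hXrank : (X.rank : ℝ) = d := by rw [BohrSet.rank, hXf, hd, BohrSet.rank]
    have hfin := norm_char_sub_one_le hXreg (χ := χ) (by rw [hXf]; exact hhalf)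
      (τ := κ / (96 * d)) (by positivity) ?_ (t := t) ?_
    · rw [hXrank] at hfin
      have : 48 * d * (κ / (96 * d)) = κ / 2 := by field_simp; norm_num
      linarith
    · rw [hXrank]
      have : 12 * d * (κ / (96 * d)) = κ / 8 := by field_simp; norm_num
      linarith
    · rw [BohrSet.dilate, hXf]
      refine bohr_mono _ ?_ htB
      -- Here 73728 = 96 · 12 · 64: the dilation factor making χ(t) vary by κ/2, the radius of X,
      -- and the loss in passing to a regular dilate.
      calc r = κ / (96 * d) * (ρ / (12 * d * n) / 64) := by rw [hr]; field_simp; ring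
        _ ≤ _ := by gcongr

end Smoothing

/-! ### Moment bounds for sums of independent variables. -/

section Moments
set_option linter.unusedSectionVars false

/-- Half-angle identities give sinh(w/2) ≥ (w/4) e^{w/4} ≥ (w/4m)^m, and cosh w - 1 = 2 sinh²(w/2).
Retaining the -1 makes the resulting moment bound linear in the variance when the variance is small.
-/
lemma abs_rpow_le_cosh {m : ℝ} (hm : 1 ≤ m) (z : ℝ) :
    |z| ^ (2 * m) ≤ (4 * m) ^ (2 * m) * (Real.cosh z - 1) := by
  rw [← Real.cosh_abs]
  set w := |z| with hw
  have hw0 : 0 ≤ w := abs_nonneg z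
  have hc : Real.cosh w - 1 = 2 * Real.sinh (w / 2) ^ 2 := by
    have h1 := Real.cosh_two_mul (w / 2)
    have h2 := Real.cosh_sq (w / 2)
    rw [show 2 * (w / 2) = w by ring] at h1
    linarith
  have hs : Real.sinh (w / 2) = 2 * Real.sinh (w / 4) * Real.cosh (w / 4) := by
    rw [← Real.sinh_two_mul]; ring_nf
  have hs1 : w / 4 ≤ Real.sinh (w / 4) := Real.self_le_sinh_iff.2 (by positivity)
  have hc1 : Real.exp (w / 4) / 2 ≤ Real.cosh (w / 4) := by
    rw [Real.cosh_eq]; have := Real.exp_pos (-(w / 4)); linarith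
  have he : (w / (4 * m)) ^ (m - 1) ≤ Real.exp (w / 4) := by
    calc (w / (4 * m)) ^ (m - 1) ≤ Real.exp (w / (4 * m)) ^ (m - 1) := by
          refine Real.rpow_le_rpow (by positivity) ?_ (by linarith)
          linarith [Real.add_one_le_exp (w / (4 * m))]
      _ = Real.exp (w / (4 * m) * (m - 1)) := by rw [Real.exp_mul]
      _ ≤ Real.exp (w / 4) := by
          refine Real.exp_le_exp.2 ?_
          have : w / (4 * m) * (m - 1) = w / 4 - w / (4 * m) := by field_simp
          have : 0 ≤ w / (4 * m) := by positivity
          linarith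
  have hsinh : (w / (4 * m)) ^ m ≤ Real.sinh (w / 2) := by
    rcases hw0.eq_or_lt with h | h
    · rw [← h]; simp [Real.zero_rpow (by linarith : m ≠ 0)]
    have hq : 0 < w / (4 * m) := by positivity
    have h1 : (w / (4 * m)) ^ m = w / (4 * m) * (w / (4 * m)) ^ (m - 1) := by
      rw [Real.rpow_sub_one hq.ne']; field_simp
    rw [h1, hs]
    calc w / (4 * m) * (w / (4 * m)) ^ (m - 1) ≤ (w / 4) * Real.exp (w / 4) := by
          refine mul_le_mul ?_ he (by positivity) (by positivity)
          exact div_le_div_of_nonneg_left hw0 (by norm_num) (by linarith)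
      _ = 2 * (w / 4) * (Real.exp (w / 4) / 2) := by ring
      _ ≤ 2 * Real.sinh (w / 4) * Real.cosh (w / 4) := by
          refine mul_le_mul (by linarith) hc1 (by positivity) ?_
          have : 0 ≤ w / 4 := by positivity
          linarith
  have h3 : (w / (4 * m)) ^ (2 * m) ≤ Real.cosh w - 1 := by
    rw [hc, mul_comm 2 m, Real.rpow_mul (by positivity), Real.rpow_two]
    have h4 : 0 ≤ (w / (4 * m)) ^ m := by positivity
    nlinarith [pow_le_pow_left₀ h4 hsinh 2]
  calc w ^ (2 * m) = (4 * m * (w / (4 * m))) ^ (2 * m) := by congr 1; field_simp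
    _ = (4 * m) ^ (2 * m) * (w / (4 * m)) ^ (2 * m) :=
        Real.mul_rpow (by positivity) (by positivity)
    _ ≤ _ := mul_le_mul_of_nonneg_left h3 (by positivity)

variable {α : Type*} [DecidableEq α]

/-- The exponential moment of a sum of independent centred bounded variables. -/
lemma sum_exp_le {A : Finset α} {y : α → ℝ} {v l : ℝ} (n : ℕ) (hy0 : ∑ a ∈ A, y a = 0)
    (hy1 : ∀ a ∈ A, |y a| ≤ 1) (hv : ∑ a ∈ A, y a ^ 2 = A.card * v) (hl : |l| ≤ 1) :
    ∑ a ∈ Fintype.piFinset fun _ : Fin n => A, Real.exp (l * ∑ i, y (a i))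
      ≤ A.card ^ n * Real.exp (n * v * l ^ 2) := by
  have h1 : ∑ a ∈ Fintype.piFinset fun _ : Fin n => A, Real.exp (l * ∑ i, y (a i))
      = (∑ a ∈ A, Real.exp (l * y a)) ^ n := by
    simp_rw [Finset.mul_sum, Real.exp_sum]
    rw [← Finset.prod_univ_sum (fun _ : Fin n => A) (fun _ a => Real.exp (l * y a))]
    simp
  have h2 : ∑ a ∈ A, Real.exp (l * y a) ≤ A.card * Real.exp (v * l ^ 2) := by
    calc ∑ a ∈ A, Real.exp (l * y a) ≤ ∑ a ∈ A, (1 + l * y a + l ^ 2 * y a ^ 2) := by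
          refine Finset.sum_le_sum fun a ha => ?_
          have hb : |l * y a| ≤ 1 := by
            rw [abs_mul]; exact mul_le_one₀ hl (abs_nonneg _) (hy1 a ha)
          have := (abs_le.1 (Real.abs_exp_sub_one_sub_id_le hb)).2
          linarith [mul_pow l (y a) 2]
      _ = A.card * (v * l ^ 2 + 1) := by
          rw [Finset.sum_add_distrib, Finset.sum_add_distrib, ← Finset.mul_sum, ← Finset.mul_sum,
            hy0, hv]
          simp; ring
      _ ≤ _ := mul_le_mul_of_nonneg_left (Real.add_one_le_exp _) (by positivity)
  rw [h1]
  refine (pow_le_pow_left₀ (Finset.sum_nonneg fun _ _ => (Real.exp_pos _).le) h2 n).trans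
    (le_of_eq ?_)
  rw [mul_pow, ← Real.exp_nat_mul]; ring_nf

lemma sum_cosh_le {A : Finset α} {y : α → ℝ} {v l : ℝ} (n : ℕ) (hy0 : ∑ a ∈ A, y a = 0)
    (hy1 : ∀ a ∈ A, |y a| ≤ 1) (hv : ∑ a ∈ A, y a ^ 2 = A.card * v) (hl : |l| ≤ 1) :
    ∑ a ∈ Fintype.piFinset fun _ : Fin n => A, (Real.cosh (l * ∑ i, y (a i)) - 1)
      ≤ A.card ^ n * (Real.exp (n * v * l ^ 2) - 1) := by
  have h1 := sum_exp_le n hy0 hy1 hv hl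
  have h2 := sum_exp_le n hy0 hy1 hv (l := -l) (by rwa [abs_neg])
  simp_rw [Real.cosh_eq, ← neg_mul]
  rw [Finset.sum_sub_distrib, ← Finset.sum_div, Finset.sum_add_distrib]
  simp only [Finset.sum_const, Fintype.card_piFinset, Finset.prod_const, Finset.card_univ,
    Fintype.card_fin, nsmul_eq_mul, mul_one]
  rw [neg_sq] at h2
  push_cast
  linarith

/-- A Rosenthal-type moment bound for sums of independent centred bounded variables. -/
lemma sum_abs_rpow_le {A : Finset α} {y : α → ℝ} {v m : ℝ} {n : ℕ} (hm : 1 ≤ m)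
    (hv0 : 0 ≤ v) (hy0 : ∑ a ∈ A, y a = 0)
    (hy1 : ∀ a ∈ A, |y a| ≤ 1) (hv : ∑ a ∈ A, y a ^ 2 = A.card * v) :
    ∑ a ∈ Fintype.piFinset fun _ : Fin n => A, |∑ i, y (a i)| ^ (2 * m)
      ≤ A.card ^ n * ((48 * m * (n * v)) ^ m + (48 * m ^ 2) ^ m * (n * v)) := by
  have hm0 : 0 < m := by linarith
  have hnv : 0 ≤ n * v := by positivity
  have hexp : Real.exp m ≤ 3 ^ m := by
    rw [← one_mul m, Real.exp_mul, one_mul]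
    exact Real.rpow_le_rpow (Real.exp_pos _).le (by linarith [Real.exp_one_lt_d9]) hm0.le
  have e16 : (4 * m) ^ (2 * m) = (16 * m ^ 2) ^ m := by
    rw [Real.rpow_mul (by positivity), Real.rpow_two]; ring_nf
  -- If nv ≥ m, the choice l² = m/(nv) ≤ 1 makes the exponent equal to m (Gaussian regime).
  -- Otherwise l = 1 and exp(nv) - 1 ≤ nv · 3^m (Poisson regime).
  rcases le_total m (n * v) with h | h
  · have hnv0 : 0 < n * v := hm0.trans_le h
    set l := √(m / (n * v)) with hl
    have hl0 : 0 < l := Real.sqrt_pos.2 (by positivity)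
    have hl2 : l ^ 2 = m / (n * v) := Real.sq_sqrt (by positivity)
    have hl1 : |l| ≤ 1 := by
      rw [abs_of_pos hl0, hl]
      exact Real.sqrt_le_one.2 ((div_le_one hnv0).2 h)
    have hcosh := sum_cosh_le n hy0 hy1 hv hl1
    have hstep : ∀ a : Fin n → α, |∑ i, y (a i)| ^ (2 * m) ≤
        (16 * m * (n * v)) ^ m * (Real.cosh (l * ∑ i, y (a i)) - 1) := by
      intro a
      have h1 := abs_rpow_le_cosh hm (l * ∑ i, y (a i))
      rw [abs_mul, abs_of_pos hl0, Real.mul_rpow hl0.le (abs_nonneg _), e16,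
        Real.rpow_mul hl0.le, Real.rpow_two, hl2] at h1
      have h2 : (16 * m ^ 2) ^ m = (m / (n * v)) ^ m * (16 * m * (n * v)) ^ m := by
        rw [← Real.mul_rpow (by positivity) (by positivity)]; congr 1
        field_simp [hnv0.ne']
        rw [div_self hnv0.ne']
      rw [h2, mul_assoc] at h1
      exact le_of_mul_le_mul_left h1 (by positivity)
    refine (Finset.sum_le_sum fun a _ => hstep a).trans ?_
    rw [← Finset.mul_sum]
    have h3 : (n * v) * l ^ 2 = m := by rw [hl2, mul_div_cancel₀ _ hnv0.ne']
    rw [h3] at hcosh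
    calc _ ≤ (16 * m * (n * v)) ^ m * (A.card ^ n * (Real.exp m - 1)) :=
          mul_le_mul_of_nonneg_left hcosh (by positivity)
      _ ≤ (16 * m * (n * v)) ^ m * (A.card ^ n * 3 ^ m) := by gcongr; linarith
      _ = A.card ^ n * (48 * m * (n * v)) ^ m := by
          have h4 : (48 * m * (n * v)) ^ m = (16 * m * (n * v)) ^ m * 3 ^ m := by
            rw [← Real.mul_rpow (by positivity) (by norm_num)]; ring_nf
          rw [h4]; ring
      _ ≤ _ := by
          gcongr
          linarith [show 0 ≤ (48 * m ^ 2) ^ m * (n * v) by positivity]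
  · have hcosh := sum_cosh_le (l := 1) n hy0 hy1 hv (by simp)
    simp only [one_mul, one_pow, mul_one] at hcosh
    have h1 : Real.exp (n * v) - 1 ≤ (n * v) * 3 ^ m := by
      have h2 := Real.add_one_le_exp (-(n * v))
      have h3 : Real.exp (n * v) * Real.exp (-(n * v)) = 1 := by rw [← Real.exp_add]; simp
      have h4 : Real.exp (n * v) ≤ 3 ^ m := (Real.exp_le_exp.2 h).trans hexp
      have h5 := Real.exp_pos (n * v)
      nlinarith
    refine (Finset.sum_le_sum fun a _ => abs_rpow_le_cosh hm _).trans ?_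
    rw [← Finset.mul_sum, e16]
    calc _ ≤ (16 * m ^ 2) ^ m * (A.card ^ n * ((n * v) * 3 ^ m)) :=
          mul_le_mul_of_nonneg_left (hcosh.trans (by gcongr)) (by positivity)
      _ = A.card ^ n * ((48 * m ^ 2) ^ m * (n * v)) := by
          have h4 : (48 * m ^ 2) ^ m = (16 * m ^ 2) ^ m * 3 ^ m := by
            rw [← Real.mul_rpow (by positivity) (by norm_num)]; ring_nf
          rw [h4]; ring
      _ ≤ _ := by
          gcongr
          linarith [show 0 ≤ (48 * m * (n * v)) ^ m by positivity]

/-- The moment bound normalised: if `96 m ≤ n θ²` then the `2m`-th moment of the average of `n`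
independent copies is at most `θ^{2m} v^m + θ^{4m-2} v`. -/
lemma sum_abs_avg_rpow_le {A : Finset α} {y : α → ℝ} {v m θ : ℝ} {n : ℕ} (hm : 1 ≤ m)
    (hn : 96 * m ≤ n * θ ^ 2)
    (hv0 : 0 ≤ v) (hy0 : ∑ a ∈ A, y a = 0)
    (hy1 : ∀ a ∈ A, |y a| ≤ 1) (hv : ∑ a ∈ A, y a ^ 2 = A.card * v) :
    ∑ a ∈ Fintype.piFinset fun _ : Fin n => A, |(∑ i, y (a i)) / n| ^ (2 * m)
      ≤ A.card ^ n * ((θ ^ 2) ^ m * v ^ m + (θ ^ 2) ^ (2 * m - 1) * v) := by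
  have hm0 : 0 < m := by linarith
  have hn0 : 0 < (n : ℝ) := by
    by_contra hcon
    have : (n : ℝ) = 0 := le_antisymm (not_lt.1 hcon) (by positivity)
    rw [this] at hn; linarith
  have hsum := sum_abs_rpow_le (n := n) hm hv0 hy0 hy1 hv
  have hq : 96 * m / n ≤ θ ^ 2 := by rw [div_le_iff₀ hn0]; linarith
  have e : ∀ a : Fin n → α, |(∑ i, y (a i)) / n| ^ (2 * m)
      = |∑ i, y (a i)| ^ (2 * m) / (n : ℝ) ^ (2 * m) := by
    intro a
    rw [abs_div, Nat.abs_cast, Real.div_rpow (abs_nonneg _) hn0.le]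
  simp_rw [e]
  rw [← Finset.sum_div, div_le_iff₀ (by positivity), mul_assoc]
  refine hsum.trans (mul_le_mul_of_nonneg_left ?_ (by positivity))
  rw [add_mul]
  refine add_le_add ?_ ?_
  · have : (48 * m * (n * v)) ^ m = (48 * m / n) ^ m * v ^ m * (n : ℝ) ^ (2 * m) := by
      rw [Real.rpow_mul hn0.le, Real.rpow_two, ← Real.mul_rpow (by positivity) (by positivity),
        ← Real.mul_rpow (by positivity) (by positivity)]
      congr 1; field_simp
    rw [this]
    have h48 : 48 * m / n ≤ θ ^ 2 := le_trans (by gcongr; norm_num) hq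
    gcongr
  -- The Poisson term carries a surplus factor m, absorbed by 48^m · m ≤ 96^m; hence 96 in the
  -- hypothesis on n.
  · have h2m : m ≤ 2 ^ m := by
      have h1 := one_add_mul_self_le_rpow_one_add (s := 1) (by norm_num) hm
      norm_num at h1; linarith
    have h3 : (48 * m ^ 2) ^ m * n ≤ (96 * m / n) ^ (2 * m - 1) * (n : ℝ) ^ (2 * m) := by
      rw [Real.div_rpow (by positivity) hn0.le, div_mul_eq_mul_div, mul_div_assoc,
        ← Real.rpow_sub hn0, show 2 * m - (2 * m - 1) = 1 by ring, Real.rpow_one]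
      refine mul_le_mul_of_nonneg_right ?_ hn0.le
      have hmm : (m ^ 2) ^ m = m ^ (2 * m - 1) * m := by
        rw [← Real.rpow_two, ← Real.rpow_mul hm0.le, Real.rpow_sub_one hm0.ne']; field_simp
      rw [Real.mul_rpow (by norm_num) (by positivity), Real.mul_rpow (by norm_num) hm0.le, hmm]
      have h96 : (48 : ℝ) ^ m * m ≤ 96 ^ (2 * m - 1) := by
        calc (48 : ℝ) ^ m * m ≤ 48 ^ m * 2 ^ m := by gcongr
          _ = 96 ^ m := by rw [← Real.mul_rpow (by norm_num) (by norm_num)]; norm_num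
          _ ≤ 96 ^ (2 * m - 1) := Real.rpow_le_rpow_of_exponent_le (by norm_num) (by linarith)
      calc (48 : ℝ) ^ m * (m ^ (2 * m - 1) * m) = (48 ^ m * m) * m ^ (2 * m - 1) := by ring
        _ ≤ _ := by gcongr
    calc (48 * m ^ 2) ^ m * (n * v) = ((48 * m ^ 2) ^ m * n) * v := by ring
      _ ≤ ((96 * m / n) ^ (2 * m - 1) * (n : ℝ) ^ (2 * m)) * v := by gcongr
      _ ≤ ((θ ^ 2) ^ (2 * m - 1) * (n : ℝ) ^ (2 * m)) * v := by
          have : 0 ≤ 2 * m - 1 := by linarith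
          gcongr
      _ = _ := by ring

end Moments

/-! ### Croot–Sisask sampling. -/

section CrootSisask
set_option linter.unusedSectionVars false
open MeasureTheory

/-- Markov's inequality. The values M = 0 and M = ⊤ are treated separately because M has to be
cancelled. -/
lemma card_le_two_mul_card_filter {ι : Type*} (s : Finset ι) (E : ι → ENNReal) {M : ENNReal}
    (h : ∑ a ∈ s, E a ≤ s.card * M) [DecidablePred fun a => E a ≤ 2 * M] :
    s.card ≤ 2 * (s.filter fun a => E a ≤ 2 * M).card := by
  rcases eq_or_ne M 0 with rfl | h0
  · rw [mul_zero, nonpos_iff_eq_zero, Finset.sum_eq_zero_iff] at h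
    rw [Finset.filter_true_of_mem fun a ha => by rw [h a ha]; exact zero_le]
    omega
  rcases eq_or_ne M ⊤ with rfl | ht
  · rw [Finset.filter_true_of_mem fun a _ => by rw [ENNReal.mul_top (by norm_num)]; exact le_top]
    omega
  have h1 : (((s.filter fun a => ¬ E a ≤ 2 * M).card * 2 : ℕ) : ENNReal) * M ≤ s.card * M := by
    refine le_trans ?_ h
    calc (((s.filter fun a => ¬ E a ≤ 2 * M).card * 2 : ℕ) : ENNReal) * M
        = ∑ a ∈ s.filter fun a => ¬ E a ≤ 2 * M, 2 * M := by
          rw [Finset.sum_const, nsmul_eq_mul]; push_cast; ring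
      _ ≤ ∑ a ∈ s.filter fun a => ¬ E a ≤ 2 * M, E a :=
          Finset.sum_le_sum fun a ha => (not_le.1 (Finset.mem_filter.1 ha).2).le
      _ ≤ _ := Finset.sum_le_sum_of_subset (Finset.filter_subset _ _)
  have h2 := (ENNReal.mul_le_mul_iff_left h0 ht).1 h1
  have h3 : (s.filter fun a => ¬ E a ≤ 2 * M).card * 2 ≤ s.card := by exact_mod_cast h2
  have h4 := Finset.card_filter_add_card_filter_not (s := s) (fun a => E a ≤ 2 * M)
  omega

variable {G : Type*} [AddCommGroup G] [Fintype G] [DecidableEq G]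

lemma ind_nonneg (X : Finset G) (x : G) : 0 ≤ ind X x := by
  unfold ind; split_ifs <;> norm_num

lemma ind_le_one (X : Finset G) (x : G) : ind X x ≤ 1 := by
  unfold ind; split_ifs <;> norm_num

/-- The average of the translates of `1_L` by the entries of `a`. -/
noncomputable def translateAvg {n : ℕ} (L : Finset G) (a : Fin n → G) (x : G) : ℝ :=
  (∑ i, ind L (x - a i)) / n

/-- For fixed x and a uniform in A, 1_L(x - a) has mean g(x) and, being 0 or 1, variance g(x)(1 -
g(x)). This is the source of f. -/
lemma sum_translateAvg_sub_rpow_le {A L : Finset G} (hA : A.Nonempty) {m θ : ℝ} {n : ℕ}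
    (hm : 1 ≤ m) (hn : 96 * m ≤ n * θ ^ 2) {g : G → ℝ} (hg : g = conv (unif A) (ind L)) (x : G) :
    0 ≤ g x * (1 - g x) ∧
    ∑ a ∈ Fintype.piFinset fun _ : Fin n => A, |translateAvg L a x - g x| ^ (2 * m)
      ≤ A.card ^ n * ((θ ^ 2) ^ m * (g x * (1 - g x)) ^ m
        + (θ ^ 2) ^ (2 * m - 1) * (g x * (1 - g x))) := by
  have hApos : (0 : ℝ) < A.card := by exact_mod_cast hA.card_pos
  have hn0 : (n : ℝ) ≠ 0 := by
    intro h; rw [h] at hn; linarith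
  have hgx : A.card * g x = ∑ a ∈ A, ind L (x - a) := by
    rw [hg, conv_unif_apply]; field_simp
  have hg0 : 0 ≤ g x := by rw [hg]; exact conv_unif_nonneg A (ind_nonneg L) x
  have hg1 : g x ≤ 1 := by
    have : ∑ a ∈ A, ind L (x - a) ≤ A.card := by
      refine (Finset.sum_le_sum fun a _ => ind_le_one L (x - a)).trans (by simp)
    rw [← hgx] at this
    nlinarith
  have hv0 : 0 ≤ g x * (1 - g x) := mul_nonneg hg0 (by linarith)
  refine ⟨hv0, ?_⟩
  have h := sum_abs_avg_rpow_le (A := A) (y := fun a => ind L (x - a) - g x) (n := n) hm hn hv0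
    (by rw [Finset.sum_sub_distrib, ← hgx]; simp)
    (fun a _ => by
      have h1 := ind_nonneg L (x - a)
      have h2 := ind_le_one L (x - a)
      rw [abs_le]; constructor <;> linarith)
    (by
      have h1 : ∀ a, (ind L (x - a) - g x) ^ 2 = (1 - 2 * g x) * ind L (x - a) + g x ^ 2 := by
        intro a
        have : ind L (x - a) ^ 2 = ind L (x - a) := by unfold ind; split_ifs <;> norm_num
        linear_combination this
      simp_rw [h1]
      rw [Finset.sum_add_distrib, ← Finset.mul_sum, ← hgx]
      simp; ring)
  refine le_trans (le_of_eq (Finset.sum_congr rfl fun a _ => ?_)) h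
  congr 2
  rw [translateAvg, Finset.sum_sub_distrib, sub_div]
  simp [hn0]

variable [MeasurableSpace G] [DiscreteMeasurableSpace G]

lemma eLpNorm_ofReal_eq {p : ℝ} (hp : 0 < p) (u : G → ℝ) (μ : Measure G) :
    eLpNorm u (ENNReal.ofReal p) μ = (∫⁻ x, ENNReal.ofReal (|u x| ^ p) ∂μ) ^ (1 / p) := by
  rw [eLpNorm_eq_lintegral_rpow_enorm_toReal (by simpa using hp) ENNReal.ofReal_ne_top,
    ENNReal.toReal_ofReal hp.le]
  congr 2
  funext x
  rw [← ENNReal.ofReal_rpow_of_nonneg (abs_nonneg _) hp.le, Real.enorm_eq_ofReal_abs]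

/-- The power 1/(2m) is subadditive, which separates the two moment terms; Markov's factor 2 remains
at most 2 after taking the root. -/
lemma rpow_two_mul_add_le {m θ : ℝ} (hm : 1 ≤ m) (hθ : 0 < θ) {f : G → ℝ} (hf : ∀ x, 0 ≤ f x)
    (μ : Measure G) :
    (2 * ∫⁻ x, ENNReal.ofReal ((θ ^ 2) ^ m * f x ^ m + (θ ^ 2) ^ (2 * m - 1) * f x) ∂μ)
        ^ (1 / (2 * m))
      ≤ 2 * (ENNReal.ofReal θ * eLpNorm f (ENNReal.ofReal m) μ ^ (1 / 2 : ℝ)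
          + ENNReal.ofReal (θ ^ (2 - 1 / m)) * eLpNorm f 1 μ ^ (1 / (2 * m))) := by
  have hm0 : 0 < m := by linarith
  have hq0 : 0 ≤ 1 / (2 * m) := by positivity
  have hq1 : 1 / (2 * m) ≤ 1 := by rw [div_le_one (by positivity)]; linarith
  have hmeas : ∀ u : G → ENNReal, Measurable u := fun u => Measurable.of_discrete
  have hsplit : ∫⁻ x, ENNReal.ofReal ((θ ^ 2) ^ m * f x ^ m + (θ ^ 2) ^ (2 * m - 1) * f x) ∂μ
      = ENNReal.ofReal ((θ ^ 2) ^ m) * ∫⁻ x, ENNReal.ofReal (|f x| ^ m) ∂μ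
        + ENNReal.ofReal ((θ ^ 2) ^ (2 * m - 1)) * ∫⁻ x, ENNReal.ofReal (|f x| ^ (1 : ℝ)) ∂μ := by
    rw [← lintegral_const_mul _ (hmeas _), ← lintegral_const_mul _ (hmeas _),
      ← lintegral_add_left (hmeas _)]
    refine lintegral_congr fun x => ?_
    have := hf x
    rw [abs_of_nonneg this, Real.rpow_one, ← ENNReal.ofReal_mul (by positivity),
      ← ENNReal.ofReal_mul (by positivity), ENNReal.ofReal_add (by positivity) (by positivity)]
  have h1 : eLpNorm f 1 μ = ∫⁻ x, ENNReal.ofReal (|f x| ^ (1 : ℝ)) ∂μ := by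
    have := eLpNorm_ofReal_eq one_pos f μ
    rwa [ENNReal.ofReal_one, div_one, ENNReal.rpow_one] at this
  rw [hsplit, ← h1, eLpNorm_ofReal_eq hm0, ENNReal.mul_rpow_of_nonneg _ _ hq0]
  refine mul_le_mul' ?_ ?_
  · calc (2 : ENNReal) ^ (1 / (2 * m)) ≤ 2 ^ (1 : ℝ) :=
        ENNReal.rpow_le_rpow_of_exponent_le (by norm_num) hq1
      _ = 2 := ENNReal.rpow_one _
  · refine (ENNReal.rpow_add_le_add_rpow _ _ hq0 hq1).trans (le_of_eq ?_)
    rw [ENNReal.mul_rpow_of_nonneg _ _ hq0, ENNReal.mul_rpow_of_nonneg _ _ hq0,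
      ENNReal.ofReal_rpow_of_nonneg (by positivity) hq0,
      ENNReal.ofReal_rpow_of_nonneg (by positivity) hq0, ← ENNReal.rpow_mul]
    congr 2
    · congr 1
      rw [← Real.rpow_two, ← Real.rpow_mul hθ.le, ← Real.rpow_mul hθ.le]
      have : 2 * m * (1 / (2 * m)) = 1 := by field_simp
      rw [this, Real.rpow_one]
    · congr 1; field_simp
    · congr 1
      rw [← Real.rpow_two, ← Real.rpow_mul hθ.le, ← Real.rpow_mul hθ.le]
      congr 1; field_simp

/-- The Croot–Sisask sampling lemma, in `L^{2m}` of an arbitrary measure. -/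
theorem croot_sisask {A L S : Finset G} (hA : A.Nonempty) (hS : S.Nonempty) {m θ K : ℝ} {n : ℕ}
    (hm : 1 ≤ m) (hθ : 0 < θ) (hn : 96 * m ≤ n * θ ^ 2)
    (hAS : ((A + S).card : ℝ) ≤ K * A.card) (μ : Measure G) {g : G → ℝ}
    (hg : g = conv (unif A) (ind L)) :
    ∃ T ⊆ S, T.Nonempty ∧ (S.card : ℝ) ≤ 2 * K ^ n * T.card ∧ ∃ h : G → ℝ, ∀ t ∈ T,
      eLpNorm (fun x => h (x + t) - g x) (ENNReal.ofReal (2 * m)) μ ≤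
        2 * (ENNReal.ofReal θ *
            eLpNorm (fun x => g x * (1 - g x)) (ENNReal.ofReal m) μ ^ (1 / 2 : ℝ)
          + ENNReal.ofReal (θ ^ (2 - 1 / m)) *
            eLpNorm (fun x => g x * (1 - g x)) 1 μ ^ (1 / (2 * m))) := by
  classical
  have hm0 : 0 < m := by linarith
  set f : G → ℝ := fun x => g x * (1 - g x) with hf
  have hpt := sum_translateAvg_sub_rpow_le (L := L) hA hm hn hg
  have hf0 : ∀ x, 0 ≤ f x := fun x => (hpt x).1
  set I := Fintype.piFinset fun _ : Fin n => A with hI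
  have hIcard : I.card = A.card ^ n := by simp [hI]
  set E : (Fin n → G) → ENNReal := fun a =>
    ∫⁻ x, ENNReal.ofReal (|translateAvg L a x - g x| ^ (2 * m)) ∂μ with hE
  set M := ∫⁻ x, ENNReal.ofReal ((θ ^ 2) ^ m * f x ^ m + (θ ^ 2) ^ (2 * m - 1) * f x) ∂μ with hM
  have hEsum : ∑ a ∈ I, E a ≤ I.card * M := by
    simp only [hE]
    rw [← lintegral_finsetSum _ fun _ _ => Measurable.of_discrete, hM,
      ← lintegral_const_mul _ Measurable.of_discrete]
    refine lintegral_mono fun x => ?_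
    rw [← ENNReal.ofReal_sum_of_nonneg fun _ _ => by positivity, ← ENNReal.ofReal_natCast,
      ← ENNReal.ofReal_mul (by positivity), hIcard]
    refine ENNReal.ofReal_le_ofReal ?_
    push_cast
    exact (hpt x).2
  have hgood := card_le_two_mul_card_filter I E hEsum
  set J := I.filter fun a => E a ≤ 2 * M with hJ
  set P := Fintype.piFinset fun _ : Fin n => A + S with hP
  have hPcard : P.card = (A + S).card ^ n := by simp [hP]
  have hmaps : ∀ q ∈ J ×ˢ S, (fun i => q.1 i + q.2) ∈ P := by
    intro q hq
    rw [Finset.mem_product] at hq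
    have h1 := (Finset.mem_filter.1 hq.1).1
    rw [hI, Fintype.mem_piFinset] at h1
    rw [hP, Fintype.mem_piFinset]
    exact fun i => Finset.add_mem_add (h1 i) hq.2
  have hPne : P.Nonempty := by
    rw [hP, Fintype.piFinset_nonempty]; exact fun _ => hA.add hS
  have hPpos : (0 : ℝ) < P.card := by exact_mod_cast hPne.card_pos
  -- Pigeonhole for (a, t) ↦ a + t on good tuples times S. A popular value z has many t with z - t
  -- good, and shifting the average for z by t yields the average for z - t.
  obtain ⟨z, -, hz⟩ := Finset.exists_le_card_fiber_of_nsmul_le_card_of_maps_to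
    (s := J ×ˢ S) (t := P) (f := fun q => fun i => q.1 i + q.2)
    (b := ((J ×ˢ S).card : ℝ) / P.card) hmaps hPne
    (by rw [nsmul_eq_mul, mul_div_cancel₀ _ hPpos.ne'])
  set T := S.filter fun t => (fun i => z i - t) ∈ J with hT
  have hfib : ((J ×ˢ S).filter fun q => (fun i => q.1 i + q.2) = z).card ≤ T.card := by
    refine Finset.card_le_card_of_injOn Prod.snd ?_ ?_
    · intro q hq
      rw [Finset.mem_coe, Finset.mem_filter, Finset.mem_product] at hq
      rw [Finset.mem_coe, hT, Finset.mem_filter]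
      refine ⟨hq.1.2, ?_⟩
      rw [← hq.2]
      simpa using hq.1.1
    · intro q hq q' hq' h
      rw [Finset.mem_coe, Finset.mem_filter] at hq hq'
      refine Prod.ext (funext fun i => ?_) h
      have h1 := congrFun hq.2 i
      have h2 := congrFun hq'.2 i
      exact add_right_cancel (h1.trans (h ▸ h2.symm))
  have hApos : (0 : ℝ) < A.card := by exact_mod_cast hA.card_pos
  have hSpos : (0 : ℝ) < S.card := by exact_mod_cast hS.card_pos
  have hcard : (S.card : ℝ) ≤ 2 * K ^ n * T.card := by
    have h1 : ((J.card : ℝ) * S.card) ≤ T.card * P.card := by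
      have h2 : ((J ×ˢ S).card : ℝ) / P.card ≤ T.card := hz.trans (by exact_mod_cast hfib)
      rw [div_le_iff₀ hPpos, Finset.card_product] at h2
      push_cast at h2; exact h2
    have h3 : (P.card : ℝ) ≤ K ^ n * A.card ^ n := by
      rw [hPcard, ← mul_pow]; push_cast
      exact pow_le_pow_left₀ (by positivity) hAS n
    have h4 : (A.card : ℝ) ^ n ≤ 2 * J.card := by
      rw [hIcard] at hgood; exact_mod_cast hgood
    have h5 : (A.card : ℝ) ^ n * S.card ≤ A.card ^ n * (2 * K ^ n * T.card) := by
      calc (A.card : ℝ) ^ n * S.card ≤ 2 * J.card * S.card := by gcongr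
        _ = 2 * (J.card * S.card) := by ring
        _ ≤ 2 * (T.card * P.card) := by gcongr
        _ ≤ 2 * (T.card * (K ^ n * A.card ^ n)) := by gcongr
        _ = _ := by ring
    exact le_of_mul_le_mul_left h5 (by positivity)
  refine ⟨T, Finset.filter_subset _ _, ?_, hcard, translateAvg L z, fun t ht => ?_⟩
  · rw [Finset.nonempty_iff_ne_empty]
    intro h
    rw [h] at hcard
    simp at hcard
    exact hS.ne_empty hcard
  · have h1 : (fun i => z i - t) ∈ J := (Finset.mem_filter.1 ht).2
    have h2 : E (fun i => z i - t) ≤ 2 * M := (Finset.mem_filter.1 h1).2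
    have h3 : ∀ x, translateAvg L z (x + t) = translateAvg L (fun i => z i - t) x := by
      intro x
      unfold translateAvg
      congr 1
      refine Finset.sum_congr rfl fun i _ => ?_
      rw [sub_sub_eq_add_sub]
    simp_rw [h3]
    rw [eLpNorm_ofReal_eq (by positivity)]
    exact (ENNReal.rpow_le_rpow h2 (by positivity)).trans (rpow_two_mul_add_le hm hθ hf0 μ)

end CrootSisask

/-! ### Iterated sumsets. -/

section Sumset
variable {G : Type*} [AddCommGroup G]

lemma add_mem_iteratedSumset {X : Set G} {r : ℕ} {x y : G} (hx : x ∈ iteratedSumset r X)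
    (hy : y ∈ X) : x + y ∈ iteratedSumset (r + 1) X := by
  obtain ⟨s, hs, rfl⟩ := hx
  refine ⟨Fin.snoc s y, fun i => ?_, ?_⟩
  · refine Fin.lastCases ?_ (fun j => ?_) i
    · simpa using hy
    · simpa using hs j
  · rw [Fin.sum_univ_castSucc]; simp

lemma iteratedSumset_mono {X : Set G} (h0 : (0 : G) ∈ X) {r r' : ℕ} (h : r ≤ r') :
    iteratedSumset r X ⊆ iteratedSumset r' X := by
  induction h with
  | refl => exact subset_rfl
  | step _ ih => exact fun x hx => by simpa using add_mem_iteratedSumset (ih hx) h0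

lemma neg_mem_iteratedSumset {X : Set G} (hX : ∀ x ∈ X, -x ∈ X) {r : ℕ} {x : G}
    (hx : x ∈ iteratedSumset r X) : -x ∈ iteratedSumset r X := by
  obtain ⟨s, hs, rfl⟩ := hx
  exact ⟨fun i => -s i, fun i => hX _ (hs i), by simp⟩

lemma zero_mem_iteratedSumset_zero (X : Set G) : (0 : G) ∈ iteratedSumset 0 X :=
  ⟨fun _ => 0, fun i => i.elim0, by simp⟩

end Sumset

/-! ### From the sampled set to almost-periods. -/

section AlmostPeriodicity
set_option linter.unusedSectionVars false
open MeasureTheory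
variable {G : Type*} [AddCommGroup G] [Fintype G] [DecidableEq G]
  [MeasurableSpace G] [DiscreteMeasurableSpace G]

lemma aestronglyMeasurable_of_discrete (u : G → ℝ) (μ : Measure G) : AEStronglyMeasurable u μ :=
  (Measurable.of_discrete (f := u)).aestronglyMeasurable

/-- The push-forward of ν under x ↦ x + s gives X the mass ν(-s + X), so invariance at -s bounds it
by μ. -/
lemma eLpNorm_shift_le {R : Set G} {ν μ : Measure G} (h : IsInvariantPair R ν μ) {s : G}
    (hs : -s ∈ R) (U : G → ℝ) (p : ENNReal) :
    eLpNorm (fun x => U (x + s)) p ν ≤ eLpNorm U p μ := by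
  have hle : ν.map (fun x => x + s) ≤ μ := by
    rw [Measure.le_iff]
    intro X hX
    rw [Measure.map_apply Measurable.of_discrete hX]
    refine le_trans (le_of_eq ?_) (h _ hs X hX)
    congr 1
    ext x
    simp only [Set.mem_preimage, Set.mem_image]
    constructor
    · intro hx; exact ⟨x + s, hx, by abel⟩
    · rintro ⟨y, hy, rfl⟩; simpa using hy
  have hmap := eLpNorm_map_measure (p := p) (aestronglyMeasurable_of_discrete U _)
    (Measurable.of_discrete (f := fun x : G => x + s)).aemeasurable (μ := ν)
  calc _ = eLpNorm U p (ν.map (fun x => x + s)) := hmap.symm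
    _ ≤ _ := eLpNorm_mono_measure _ hle

lemma eLpNorm_average_le {T : Finset G} (hT : T.Nonempty) {V : G → G → ℝ} {p : ENNReal}
    (hp : 1 ≤ p) {ν : Measure G} {c : ENNReal} (h : ∀ t ∈ T, eLpNorm (V t) p ν ≤ c) :
    eLpNorm (fun x => (∑ t ∈ T, V t x) / T.card) p ν ≤ c := by
  have hpos : (0 : ℝ) < T.card := by exact_mod_cast hT.card_pos
  have h1 : (fun x => (∑ t ∈ T, V t x) / T.card) = (T.card : ℝ)⁻¹ • ∑ t ∈ T, V t := by
    funext x
    simp [div_eq_inv_mul]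
  rw [h1, eLpNorm_const_smul]
  calc _ ≤ ‖(T.card : ℝ)⁻¹‖ₑ * ∑ t ∈ T, eLpNorm (V t) p ν := by
        gcongr
        exact eLpNorm_sum_le (fun _ _ => aestronglyMeasurable_of_discrete _ _) hp
    _ ≤ ‖(T.card : ℝ)⁻¹‖ₑ * (T.card * c) := by
        gcongr
        exact (Finset.sum_le_sum h).trans (by simp)
    _ = c := by
        have h2 : ‖(T.card : ℝ)⁻¹‖ₑ * (T.card : ENNReal) = 1 := by
          rw [Real.enorm_eq_ofReal (by positivity), ← ENNReal.ofReal_natCast,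
            ← ENNReal.ofReal_mul (by positivity), inv_mul_cancel₀ hpos.ne', ENNReal.ofReal_one]
        rw [← mul_assoc, h2, one_mul]

/-- Averaging a function over its translates by `t₀ - t`, `t ∈ T`. -/
noncomputable def smooth (T : Finset G) (t₀ : G) (u : G → ℝ) (x : G) : ℝ :=
  conv (unif T) u (x + t₀)

lemma norm_ft_iterate_smooth (T : Finset G) (t₀ : G) (u : G → ℝ) (k : ℕ) (γ : AddChar G ℂ) :
    ‖ft ((smooth T t₀)^[k] u) γ‖ = ‖ft (unif T) γ‖ ^ k * ‖ft u γ‖ := by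
  induction k with
  | zero => simp
  | succ k ih =>
    rw [Function.iterate_succ_apply']
    have : ft (smooth T t₀ ((smooth T t₀)^[k] u)) γ
      = γ (-t₀) * (ft (unif T) γ * ft ((smooth T t₀)^[k] u) γ) := by
      rw [← ft_conv]; exact ft_shift _ _ _
    rw [this, norm_mul, AddChar.norm_apply, one_mul, norm_mul, ih]
    ring

section Iteration
variable {X T : Set G} {r : ℕ} {ν μ : Measure G} {p b : ENNReal} {g h : G → ℝ}

/-- Both values of g are close to the same number h(x + s + t₀): one through t₀, the other through
t. The second comparison shifts by s + t₀ - t, whence j + 2 ≤ r. -/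
lemma eLpNorm_shift_sub_shift_le (hX0 : (0 : G) ∈ X) (hXneg : ∀ x ∈ X, -x ∈ X)
    (hinv : IsInvariantPair (iteratedSumset r X) ν μ) (hp : 1 ≤ p) (hTX : T ⊆ X)
    (hb : ∀ t ∈ T, eLpNorm (fun x => h (x + t) - g x) p μ ≤ b) {t t₀ s : G} (ht : t ∈ T)
    (ht₀ : t₀ ∈ T) {j : ℕ} (hj : j + 2 ≤ r) (hs : s ∈ iteratedSumset j X) :
    eLpNorm (fun x => g (x + s + t₀ - t) - g (x + s)) p ν ≤ 2 * b := by
  have e : (fun x => g (x + s + t₀ - t) - g (x + s))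
      = (fun x => h (x + s + t₀) - g (x + s))
        - (fun x => h (x + (s + t₀ - t) + t) - g (x + (s + t₀ - t))) := by
    funext x
    have h1 : x + (s + t₀ - t) = x + s + t₀ - t := by abel
    simp only [Pi.sub_apply, h1, sub_add_cancel]
    ring
  rw [e, two_mul]
  refine (eLpNorm_sub_le (aestronglyMeasurable_of_discrete _ _)
    (aestronglyMeasurable_of_discrete _ _) hp).trans (add_le_add ?_ ?_)
  · refine le_trans ?_ (hb t₀ ht₀)
    exact eLpNorm_shift_le hinv (iteratedSumset_mono hX0 (by omega)
      (neg_mem_iteratedSumset hXneg hs)) (fun x => h (x + t₀) - g x) p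
  · refine le_trans ?_ (hb t ht)
    refine eLpNorm_shift_le hinv (s := s + t₀ - t) (neg_mem_iteratedSumset hXneg
      (iteratedSumset_mono hX0 hj ?_)) (fun x => h (x + t) - g x) p
    rw [sub_eq_add_neg]
    exact add_mem_iteratedSumset (add_mem_iteratedSumset hs (hTX ht₀)) (hXneg _ (hTX ht))

end Iteration

/-- Induction on k with s free: the outermost smoothing averages over shifts s + t₀ - t, lying two
summands deeper in the sumset, and adds one error 2b by Minkowski's inequality. -/
lemma eLpNorm_iterate_smooth_sub_le {X : Set G} {T : Finset G} {r : ℕ} {ν μ : Measure G}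
    {p b : ENNReal} {g h : G → ℝ} (hX0 : (0 : G) ∈ X) (hXneg : ∀ x ∈ X, -x ∈ X)
    (hinv : IsInvariantPair (iteratedSumset r X) ν μ) (hp : 1 ≤ p) (hTX : (T : Set G) ⊆ X)
    (hb : ∀ t ∈ T, eLpNorm (fun x => h (x + t) - g x) p μ ≤ b) {t₀ : G} (ht₀ : t₀ ∈ T)
    (k : ℕ) {j : ℕ} (hj : j + 2 * k ≤ r) {s : G} (hs : s ∈ iteratedSumset j X) :
    eLpNorm (fun x => (smooth T t₀)^[k] g (x + s) - g (x + s)) p ν ≤ k * (2 * b) := by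
  have hT : T.Nonempty := ⟨t₀, ht₀⟩
  have hTpos : (T.card : ℝ) ≠ 0 := by exact_mod_cast hT.card_pos.ne'
  induction k generalizing j s with
  | zero => simp
  | succ k ih =>
    set u := (smooth T t₀)^[k] g with hu
    have e : (fun x => (smooth T t₀)^[k + 1] g (x + s) - g (x + s))
        = fun x => (∑ t ∈ T, ((u (x + (s + t₀ - t)) - g (x + (s + t₀ - t)))
          + (g (x + s + t₀ - t) - g (x + s)))) / T.card := by
      funext x
      rw [Function.iterate_succ_apply', ← hu, smooth, conv_unif_apply, eq_div_iff hTpos, sub_mul,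
        div_mul_cancel₀ _ hTpos]
      have h2 : ∀ t, u (x + (s + t₀ - t)) - g (x + (s + t₀ - t))
          + (g (x + s + t₀ - t) - g (x + s)) = u (x + s + t₀ - t) - g (x + s) := by
        intro t
        have h1 : x + (s + t₀ - t) = x + s + t₀ - t := by abel
        rw [h1]; ring
      simp_rw [h2]
      rw [Finset.sum_sub_distrib, Finset.sum_const, nsmul_eq_mul, mul_comm (g (x + s))]
    rw [e]
    refine eLpNorm_average_le hT hp fun t ht => ?_
    have hst : s + t₀ - t ∈ iteratedSumset (j + 2) X := by
      rw [sub_eq_add_neg]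
      exact add_mem_iteratedSumset (add_mem_iteratedSumset hs (hTX ht₀)) (hXneg _ (hTX ht))
    have h1 := ih (j := j + 2) (by omega) hst
    have h2 := eLpNorm_shift_sub_shift_le hX0 hXneg hinv hp hTX hb ht ht₀ (by omega) hs
    refine (eLpNorm_add_le (aestronglyMeasurable_of_discrete _ _)
      (aestronglyMeasurable_of_discrete _ _) hp).trans ((add_le_add h1 h2).trans (le_of_eq ?_))
    push_cast; ring

/-- The smoothed function varies little under translations by elements annihilating the large
spectrum of `T`. -/
lemma abs_iterate_smooth_shift_sub_le {A L T : Finset G} (hA : A.Nonempty)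
    {κ : ℝ} {k : ℕ} (hk : (1 / 2 : ℝ) ^ k * 2 ≤ κ) {t t₀ : G}
    (ht : ∀ γ : AddChar G ℂ, 1 / 2 ≤ ‖ft (unif T) γ‖ → ‖γ t - 1‖ ≤ κ) (x : G) :
    |(smooth T t₀)^[k] (conv (unif A) (ind L)) (x + t)
      - (smooth T t₀)^[k] (conv (unif A) (ind L)) x| ≤ √(L.card / A.card) * κ := by
  have hκ : 0 ≤ κ := le_trans (by positivity) hk
  have h1 := abs_shift_sub_le ((smooth T t₀)^[k] (conv (unif A) (ind L))) x t
  have hN : (0 : ℝ) < Fintype.card G := by exact_mod_cast Fintype.card_pos_iff.2 ⟨x⟩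
  refine le_of_mul_le_mul_left (h1.trans ?_) hN
  calc _ ≤ ∑ γ : AddChar G ℂ, ‖ft (conv (unif A) (ind L)) γ‖ * κ := by
        refine Finset.sum_le_sum fun γ _ => ?_
        rw [norm_ft_iterate_smooth, mul_comm (‖ft (unif T) γ‖ ^ k), mul_assoc]
        refine mul_le_mul_of_nonneg_left ?_ (norm_nonneg _)
        -- On the spectrum the shift itself is small; off it the factor 2^{-k} beats the trivial
        -- bound 2.
        rcases le_or_gt (1 / 2) ‖ft (unif T) γ‖ with h | h
        · have h2 := pow_le_one₀ (n := k) (norm_nonneg _) (norm_ft_unif_le_one T γ)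
          have h3 := mul_le_mul h2 (ht γ h) (norm_nonneg _) zero_le_one
          linarith
        · refine le_trans ?_ hk
          refine mul_le_mul (pow_le_pow_left₀ (norm_nonneg _) h.le k) ?_ (norm_nonneg _)
            (by positivity)
          refine (norm_sub_le _ _).trans ?_
          rw [AddChar.norm_apply, norm_one]; norm_num
    _ ≤ (Fintype.card G * √(L.card / A.card)) * κ := by
        rw [← Finset.sum_mul]
        exact mul_le_mul_of_nonneg_right (sum_norm_ft_conv_le hA) hκ
    _ = _ := by ring

lemma eLpNorm_shift_sub_le_of_sup {u : G → ℝ} {ν : Measure G} {δ q : ℝ} (hq : 0 < q)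
    {t : G} (h : ∀ x, |u (x + t) - u x| ≤ δ) :
    eLpNorm (fun x => u (x + t) - u x) (ENNReal.ofReal q) ν
      ≤ ENNReal.ofReal δ * ν Set.univ ^ (1 / q) := by
  have h1 := eLpNorm_le_of_ae_bound (p := ENNReal.ofReal q) (μ := ν)
    (f := fun x => u (x + t) - u x) (C := δ) (Filter.Eventually.of_forall h)
  rw [ENNReal.toReal_ofReal hq.le, ← one_div, mul_comm] at h1
  exact h1

/-- The three-step comparison of a function with its smoothed version. -/
lemma eLpNorm_shift_sub_le_of_smooth {X : Set G} {T : Finset G} {r k : ℕ} {ν μ : Measure G}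
    {p b c : ENNReal} {g h : G → ℝ} (hX0 : (0 : G) ∈ X) (hXneg : ∀ x ∈ X, -x ∈ X)
    (hinv : IsInvariantPair (iteratedSumset r X) ν μ) (hp : 1 ≤ p) (hTX : (T : Set G) ⊆ X)
    (hb : ∀ t ∈ T, eLpNorm (fun x => h (x + t) - g x) p μ ≤ b) {t₀ : G} (ht₀ : t₀ ∈ T)
    (hk : 1 + 2 * k ≤ r) {t : G} (ht : t ∈ X)
    (hc : eLpNorm (fun x => (smooth T t₀)^[k] g (x + t) - (smooth T t₀)^[k] g x) p ν ≤ c) :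
    eLpNorm (fun x => g (x + t) - g x) p ν ≤ 4 * k * b + c := by
  set F := (smooth T t₀)^[k] g with hF
  have h1 : eLpNorm (fun x => F (x + t) - g (x + t)) p ν ≤ k * (2 * b) :=
    eLpNorm_iterate_smooth_sub_le hX0 hXneg hinv hp hTX hb ht₀ k hk
      (by simpa using add_mem_iteratedSumset (zero_mem_iteratedSumset_zero X) ht)
  have h2 : eLpNorm (fun x => F (x + 0) - g (x + 0)) p ν ≤ k * (2 * b) :=
    eLpNorm_iterate_smooth_sub_le hX0 hXneg hinv hp hTX hb ht₀ k (j := 0) (by omega)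
      (zero_mem_iteratedSumset_zero X)
  simp only [add_zero] at h2
  have e : (fun x => g (x + t) - g x)
      = ((fun x => F (x + t) - F x) + fun x => F x - g x) - fun x => F (x + t) - g (x + t) := by
    funext x; simp only [Pi.add_apply, Pi.sub_apply]; ring
  rw [e]
  have h3 := eLpNorm_sub_le (μ := ν) (aestronglyMeasurable_of_discrete
    ((fun x => F (x + t) - F x) + fun x => F x - g x) ν)
    (aestronglyMeasurable_of_discrete (fun x => F (x + t) - g (x + t)) ν) hp
  have h4 := eLpNorm_add_le (μ := ν) (aestronglyMeasurable_of_discrete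
    (fun x => F (x + t) - F x) ν) (aestronglyMeasurable_of_discrete (fun x => F x - g x) ν) hp
  calc _ ≤ _ := h3
    _ ≤ (c + k * (2 * b)) + k * (2 * b) :=
        add_le_add (h4.trans (add_le_add hc h2)) h1
    _ = _ := by ring

end AlmostPeriodicity

/-! ### Numerical choices. -/

section Parameters

/-- The scale ε/(8k) compensates the loss 4k from smoothing times the factor 2 from sampling; 6144 =
96 · 8². -/
lemma sample_parameters {m ε : ℝ} (hm : 1 ≤ m) (hε0 : 0 < ε) {k : ℕ} (hk : 1 ≤ k) :
    ∃ n : ℕ, 96 * m ≤ n * (ε / (8 * k)) ^ 2 ∧ (n : ℝ) ≤ 6144 * (m * (ε ^ 2)⁻¹ * k ^ 2) + 1 := by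
  have hk0 : (0 : ℝ) < k := by exact_mod_cast hk
  refine ⟨⌈6144 * (m * (ε ^ 2)⁻¹ * k ^ 2)⌉₊, ?_, (Nat.ceil_lt_add_one (by positivity)).le⟩
  have h := Nat.le_ceil (6144 * (m * (ε ^ 2)⁻¹ * (k : ℝ) ^ 2))
  calc 96 * m = 6144 * (m * (ε ^ 2)⁻¹ * k ^ 2) * (ε / (8 * k)) ^ 2 := by field_simp; norm_num
    _ ≤ _ := mul_le_mul_of_nonneg_right h (by positivity)

/-- Both logarithms exceed 0.69, so every additive constant is absorbed into the main term. -/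
lemma rank_parameter_le {m ε l lK Ls k n n₀ : ℝ} (hm : 1 ≤ m) (hε0 : 0 < ε) (hε1 : ε < 1)
    (hl : 0.69 ≤ l) (hlK : 0.69 ≤ lK) (hLs : 0 ≤ Ls) (hk0 : 0 ≤ k) (hk : k ≤ 4 * l)
    (hn : n ≤ 6144 * (m * (ε ^ 2)⁻¹ * k ^ 2) + 1)
    (hn₀ : n₀ ≤ 8 * (3 * lK + n * lK + Ls) + 1) :
    4718592 * n₀ ≤ 10 ^ 13 * (m * (ε ^ 2)⁻¹ * l ^ 2 * lK + Ls) := by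
  have hε2 : 1 ≤ (ε ^ 2)⁻¹ := (one_le_inv₀ (by positivity)).2 (pow_le_one₀ hε0.le hε1.le)
  have hM : 1 ≤ m * (ε ^ 2)⁻¹ := one_le_mul_of_one_le_of_one_le hm hε2
  set M := m * (ε ^ 2)⁻¹ with hMdef
  have hl2 : 0.476 ≤ l ^ 2 := by nlinarith
  have hQ : 0.476 ≤ M * l ^ 2 := by nlinarith
  set Q := M * l ^ 2 with hQdef
  have hk2 : k ^ 2 ≤ 16 * l ^ 2 := by nlinarith
  have hMk : M * k ^ 2 ≤ 16 * Q := by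
    have := mul_le_mul_of_nonneg_left hk2 (by linarith : 0 ≤ M)
    rw [hQdef]; linarith
  have hn' : n ≤ 98304 * Q + 1 := by linarith
  have hnK := mul_le_mul_of_nonneg_right hn' (by linarith : 0 ≤ lK)
  have hQK := mul_le_mul_of_nonneg_right hQ (by linarith : 0 ≤ lK)
  linarith

/-- The exponent 2 - 1/m is at least 1, so the power of 8k in the denominator already absorbs the
prefactor. -/
lemma eight_mul_rpow_le {ε m : ℝ} (hε0 : 0 < ε) (hm : 1 ≤ m) {k : ℕ} (hk : 1 ≤ k) :
    8 * k * (ε / (8 * k)) ^ (2 - 1 / m) ≤ ε ^ (2 - 1 / m) := by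
  have hk1 : (1 : ℝ) ≤ 8 * k := by
    have : (1 : ℝ) ≤ k := by exact_mod_cast hk
    linarith
  have hk0 : (0 : ℝ) < 8 * k := by linarith
  have he : 1 ≤ 2 - 1 / m := by
    have : 1 / m ≤ 1 := by rw [div_le_one (by linarith)]; exact hm
    linarith
  rw [Real.div_rpow hε0.le hk0.le, mul_div_assoc', div_le_iff₀ (by positivity), mul_comm]
  refine mul_le_mul_of_nonneg_left ?_ (by positivity)
  calc (8 * k : ℝ) = (8 * k : ℝ) ^ (1 : ℝ) := (Real.rpow_one _).symm
    _ ≤ _ := Real.rpow_le_rpow_of_exponent_le hk1 he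

/-- Since 2 log 2 > 1, the choice of k gives 2^k ≥ 2/(δη); then η ≤ √η. -/
lemma half_pow_mul_two_le {δ η l : ℝ} (hδ : 0 < δ) (hη0 : 0 < η) (hη1 : η ≤ 1)
    (hl : l = Real.log (2 / (δ * η))) {k : ℕ} (hk : 2 * l ≤ k) :
    (1 / 2 : ℝ) ^ k * 2 ≤ δ * √η := by
  have h1 : 2 / (δ * η) ≤ 2 ^ k := by
    rw [← Real.exp_log (show 0 < 2 / (δ * η) by positivity), ← hl,
      ← Real.exp_log (show (0 : ℝ) < 2 ^ k by positivity), Real.log_pow]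
    refine Real.exp_le_exp.2 ?_
    have := Real.log_two_gt_d9
    nlinarith
  have h2 : η ≤ √η := Real.le_sqrt_of_sq_le (by nlinarith)
  rw [div_le_iff₀ (by positivity)] at h1
  rw [one_div, inv_pow, inv_mul_le_iff₀ (by positivity)]
  have h3 : δ * η ≤ δ * √η := mul_le_mul_of_nonneg_left h2 hδ.le
  exact h1.trans (mul_le_mul_of_nonneg_left h3 (by positivity))

end Parameters

/-! ### Assembly. -/

theorem mainTheorem6 :
    ∃ C₁ C₂ : ℝ, 0 < C₁ ∧ 0 < C₂ ∧
      ∀ (G : Type*) [AddCommGroup G] [Fintype G] [DecidableEq G]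
        [MeasurableSpace G] [DiscreteMeasurableSpace G]
        (m ε δ K η : ℝ) (A L S : Finset G) (B : BohrSet G) (r : ℕ)
        (ν μ : MeasureTheory.Measure G) (g f : G → ℝ),
        1 ≤ m → 0 < ε → ε < 1 → 0 < δ → δ < 1 →
        A.Nonempty → L.Nonempty → S.Nonempty →
        η = (A.card : ℝ) / (L.card : ℝ) → η ≤ 1 →
        B.IsRegular → 1 ≤ B.rank → B.radius ≤ 2 →
        C₁ * Real.log (2 / (δ * η)) ≤ (r : ℝ) →
        IsInvariantPair (iteratedSumset r B.carrier) ν μ →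
        (S : Set G) ⊆ B.carrier →
        ((A + S).card : ℝ) ≤ K * (A.card : ℝ) →
        g = conv (unif A) (ind L) →
        f = (fun x => g x * (1 - g x)) →
        ∃ (B' : BohrSet G) (d' : ℕ),
          0 < d' ∧
          (d' : ℝ) ≤ C₂ * (m * (ε ^ 2)⁻¹ * Real.log (2 / (δ * η)) ^ 2 * Real.log (2 * K)
            + Real.log (1 / ((S.card : ℝ) / (B.carrier.ncard : ℝ)))) ∧
          B'.IsRegular ∧ B'.IsSub B ∧
          B'.rank ≤ B.rank + d' ∧
          B.radius * δ * Real.sqrt η / ((B.rank : ℝ) ^ 2 * (d' : ℝ)) ≤ B'.radius ∧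
          ∀ t ∈ B'.carrier,
            MeasureTheory.eLpNorm (fun x => g (x + t) - g x) (ENNReal.ofReal (2 * m)) ν ≤
              ENNReal.ofReal ε *
                  MeasureTheory.eLpNorm f (ENNReal.ofReal m) μ ^ (1 / 2 : ℝ)
                + ENNReal.ofReal (ε ^ (2 - 1 / m)) *
                  MeasureTheory.eLpNorm f 1 μ ^ (1 / (2 * m))
                + ENNReal.ofReal δ * ν Set.univ ^ (1 / (2 * m)) := by
  refine ⟨12, 10 ^ 13, by norm_num, by norm_num, ?_⟩
  intro G _ _ _ _ _ m ε δ K η A L S B r ν μ g f hm hε0 hε1 hδ0 hδ1 hA hL hS hη hη1 hreg hrank hrad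
    hr hinv hSB hAS hg hf
  have hApos : (0 : ℝ) < A.card := by exact_mod_cast hA.card_pos
  have hLpos : (0 : ℝ) < L.card := by exact_mod_cast hL.card_pos
  have hSpos : (0 : ℝ) < S.card := by exact_mod_cast hS.card_pos
  have hBpos : (0 : ℝ) < B.carrier.ncard := by
    exact_mod_cast ncard_bohr_pos B.freqs B.radius_nonneg
  have hη0 : 0 < η := by rw [hη]; positivity
  have hlog2 := Real.log_two_gt_d9
  have hK1 : 1 ≤ K := by
    have h1 : (A.card : ℝ) ≤ (A + S).card := by
      exact_mod_cast Finset.card_le_card_add_right hS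
    have h2 : 1 * (A.card : ℝ) ≤ K * A.card := by linarith
    exact le_of_mul_le_mul_right h2 hApos
  set l := Real.log (2 / (δ * η)) with hl
  have hl1 : 0.69 ≤ l := by
    have h1 : Real.log 2 ≤ l := by
      refine Real.log_le_log (by norm_num) ?_
      rw [le_div_iff₀ (by positivity)]
      have : δ * η ≤ 1 := mul_le_one₀ hδ1.le hη0.le hη1
      linarith
    linarith
  have hlK : 0.69 ≤ Real.log (2 * K) := by
    have h1 : Real.log 2 ≤ Real.log (2 * K) := Real.log_le_log (by norm_num) (by linarith)
    linarith
  have hlogK : Real.log K ≤ Real.log (2 * K) := Real.log_le_log (by linarith) (by linarith)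
  set k := ⌈2 * l⌉₊ with hk
  have hk2l : 2 * l ≤ k := Nat.le_ceil _
  have hk1 : 1 ≤ k := Nat.ceil_pos.2 (by linarith)
  have hkup : (k : ℝ) ≤ 2 * l + 1 := (Nat.ceil_lt_add_one (by linarith)).le
  -- The final shift and k smoothing rounds use 1 + 2k ≤ 4l + 3 summands of B, covered by 12l
  -- because l ≥ 0.69.
  have hkr : 1 + 2 * k ≤ r := by
    have : ((1 + 2 * k : ℕ) : ℝ) ≤ r := by push_cast; linarith
    exact_mod_cast this
  obtain ⟨n, hn1, hn2⟩ := sample_parameters hm hε0 hk1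
  have hk0 : (0 : ℝ) < k := by exact_mod_cast hk1
  set θ := ε / (8 * k) with hθ
  have hθ0 : 0 < θ := by positivity
  obtain ⟨T, hTS, hT, hTcard, h, hh⟩ := croot_sisask (L := L) hA hS hm hθ0 hn1 hAS μ hg
  have hTpos : (0 : ℝ) < T.card := by exact_mod_cast hT.card_pos
  have hTB : (T : Set G) ⊆ B.carrier := fun x hx => hSB (hTS hx)
  set n₀ := ⌊8 * Real.log (4 * (B.carrier.ncard / T.card))⌋₊ + 1 with hn₀
  have hn₀lt : 8 * Real.log (4 * (B.carrier.ncard / T.card)) < n₀ := by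
    rw [hn₀]; push_cast; exact Nat.lt_floor_add_one _
  set Ls := Real.log (1 / ((S.card : ℝ) / B.carrier.ncard)) with hLs
  have hLs0 : 0 ≤ Ls := by
    refine Real.log_nonneg ?_
    rw [one_div_div, one_le_div hSpos]
    have := Set.ncard_le_ncard hSB (Set.toFinite _)
    rw [Set.ncard_coe_finset] at this
    exact_mod_cast this
  have hlogT : Real.log (4 * (B.carrier.ncard / T.card)) ≤
      3 * Real.log (2 * K) + n * Real.log (2 * K) + Ls := by
    have h1 : 4 * ((B.carrier.ncard : ℝ) / T.card) ≤
        2 ^ 3 * K ^ n * (1 / ((S.card : ℝ) / B.carrier.ncard)) := by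
      rw [one_div_div, mul_div_assoc', mul_div_assoc', div_le_div_iff₀ hTpos hSpos]
      calc 4 * (B.carrier.ncard : ℝ) * S.card
          ≤ 4 * B.carrier.ncard * (2 * K ^ n * T.card) := by gcongr
        _ = _ := by ring
    have h2 := Real.log_le_log (by positivity) h1
    have h5 : Real.log (2 ^ 3 * K ^ n * (1 / ((S.card : ℝ) / B.carrier.ncard)))
        = 3 * Real.log 2 + n * Real.log K + Ls := by
      rw [Real.log_mul (by positivity) (by positivity),
        Real.log_mul (by positivity) (by positivity), Real.log_pow, Real.log_pow]
      push_cast; rfl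
    have h3 : Real.log 2 ≤ Real.log (2 * K) := Real.log_le_log (by norm_num) (by linarith)
    have h4 : n * Real.log K ≤ n * Real.log (2 * K) := by gcongr
    linarith
  have hn₀up : (n₀ : ℝ) ≤ 8 * (3 * Real.log (2 * K) + n * Real.log (2 * K) + Ls) + 1 := by
    rw [hn₀]; push_cast
    have h1 : (1 : ℝ) ≤ 4 * (B.carrier.ncard / T.card) := by
      have h2 := Set.ncard_le_ncard hTB (Set.toFinite _)
      rw [Set.ncard_coe_finset] at h2
      have := (one_le_div hTpos).2 (by exact_mod_cast h2 : (T.card : ℝ) ≤ B.carrier.ncard)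
      linarith
    have h2 := Nat.floor_le (mul_nonneg (by norm_num : (0 : ℝ) ≤ 8) (Real.log_nonneg h1))
    linarith
  have hn₀1 : (1 : ℝ) ≤ n₀ := by exact_mod_cast (by omega : 1 ≤ n₀)
  -- Chosen so that κ times the Fourier ℓ¹ bound η^{-1/2} equals δ.
  set κ := δ * √η with hκ
  have hκ0 : 0 < κ := by positivity
  have hκ1 : κ ≤ 1 := mul_le_one₀ hδ1.le (Real.sqrt_nonneg _) (Real.sqrt_le_one.2 hη1)
  obtain ⟨Λ, hΛ, hspec⟩ := chang_bohr hreg hrank hrad hT hTB hκ0 hκ1 hn₀lt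
  have hdR : (1 : ℝ) ≤ B.rank := by exact_mod_cast hrank
  have hρ := B.radius_nonneg
  set ρ₀ := B.radius * κ / (73728 * (B.rank : ℝ) ^ 2 * n₀) with hρ₀
  have hρ₀0 : 0 ≤ ρ₀ := by positivity
  have hρ₀ρ : ρ₀ ≤ B.radius := by
    have h1 : (1 : ℝ) ≤ (B.rank : ℝ) ^ 2 := one_le_pow₀ hdR
    have h2 : (1 : ℝ) ≤ (B.rank : ℝ) ^ 2 * n₀ := one_le_mul_of_one_le_of_one_le h1 hn₀1
    rw [hρ₀, div_le_iff₀ (by positivity)]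
    refine mul_le_mul_of_nonneg_left ?_ hρ
    linarith
  classical
  obtain ⟨B', hB'f, hB'1, hB'2, hB'reg⟩ := exists_regular_dilate (Γ := B.freqs ∪ Λ)
    ((Finset.card_pos.1 hrank).mono Finset.subset_union_left) hρ₀0
  -- The rank grows by at most n₀. Enlarging d' by 4718592 = 73728 · 64 absorbs the constants lost
  -- in the radius.
  refine ⟨B', 4718592 * n₀, by omega, ?_, hB'reg, ⟨?_, hB'2.trans hρ₀ρ⟩, ?_, ?_, fun t ht => ?_⟩
  · push_cast
    exact rank_parameter_le hm hε0 hε1 hl1 hlK hLs0 hk0.le (by linarith) hn2 hn₀up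
  · rw [hB'f]; exact Finset.subset_union_left
  · rw [BohrSet.rank, hB'f]
    have := Finset.card_union_le B.freqs Λ
    rw [BohrSet.rank]; omega
  · refine le_trans (le_of_eq ?_) hB'1
    rw [hρ₀, hκ]; push_cast; field_simp; ring
  have htU : t ∈ bohr (B.freqs ∪ Λ) ρ₀ := by
    rw [← hB'f]; exact bohr_mono _ hB'2 ht
  have htΓ : t ∈ bohr B.freqs ρ₀ := fun γ hγ => htU γ (Finset.mem_union_left _ hγ)
  have htΛ : t ∈ bohr Λ ρ₀ := fun γ hγ => htU γ (Finset.mem_union_right _ hγ)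
  obtain ⟨t₀, ht₀⟩ := hT
  have hsup : ∀ x, |(smooth T t₀)^[k] g (x + t) - (smooth T t₀)^[k] g x| ≤ δ := by
    intro x
    rw [hg]
    refine (abs_iterate_smooth_shift_sub_le hA (half_pow_mul_two_le hδ0 hη0 hη1 hl hk2l)
      (hspec t htΓ htΛ) x).trans (le_of_eq ?_)
    have h1 : (L.card : ℝ) / A.card = η⁻¹ := by rw [hη, inv_div]
    have : √η ≠ 0 := (Real.sqrt_pos.2 hη0).ne'
    rw [h1, Real.sqrt_inv]
    field_simp
  have hp : 1 ≤ ENNReal.ofReal (2 * m) := by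
    rw [← ENNReal.ofReal_one]; exact ENNReal.ofReal_le_ofReal (by linarith)
  have hmain := eLpNorm_shift_sub_le_of_smooth (zero_mem_bohr B.freqs hρ)
    (fun x hx => neg_mem_bohr hx) hinv hp hTB hh ht₀ hkr (bohr_mono _ hρ₀ρ htΓ)
    (eLpNorm_shift_sub_le_of_sup (by linarith) hsup)
  refine hmain.trans (add_le_add ?_ le_rfl)
  rw [hf]
  set a := MeasureTheory.eLpNorm (fun x => g x * (1 - g x)) (ENNReal.ofReal m) μ ^ (1 / 2 : ℝ)
  set b := MeasureTheory.eLpNorm (fun x => g x * (1 - g x)) 1 μ ^ (1 / (2 * m))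
  have h8 : ∀ c : ℝ, 8 * (k : ENNReal) * ENNReal.ofReal c = ENNReal.ofReal (8 * k * c) := by
    intro c
    rw [ENNReal.ofReal_mul (by positivity), ENNReal.ofReal_mul (by positivity)]
    simp
  calc _ = 8 * (k : ENNReal) * ENNReal.ofReal θ * a
        + 8 * (k : ENNReal) * ENNReal.ofReal (θ ^ (2 - 1 / m)) * b := by ring
    _ ≤ _ := by
      rw [h8, h8]
      refine add_le_add ?_ ?_
      · refine mul_le_mul_left (ENNReal.ofReal_le_ofReal (le_of_eq ?_)) _
        rw [hθ]; field_simp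
      · exact mul_le_mul_left (ENNReal.ofReal_le_ofReal (eight_mul_rpow_le hε0 hm hk1)) _
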